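/- **Setting.** Let $\mathcal S$ be a finite set of strata and $S:\mathcal Z\to\mathcal S$ a known measurable map. For each sample size $n$, participant $i=1,\dots,n$ has potential outcomes $Y_i(1),Y_i(0)\in\mathbb R$, potential treatment decisions $D_i(1),D_i(0)\in\{0,1\}$, covariates $Z_i\in\mathcal Z$, stratum $S_i=S(Z_i)$ and treatment assignment $A_i\in\{0,1\}$. Observed are $D_i=D_i(1)A_i+D_i(0)(1-A_i)$ and $Y_i=Y_i(1)D_i+Y_i(0)(1-D_i)$. Put $W^{(n)}=\{(Y_i(1),Y_i(0),D_i(0),D_i(1),Z_i)\}_{i\le n}$, $A^{(n)}=\{A_i\}_{i\le n}$, $S^{(n)}=\{S_i\}_{i\le n}$. The types are $C$ (compliers: $D(0)=0,D(1)=1$), $AT$ (always takers: $D(0)=D(1)=1$) and $NT$ (never takers: $D(0)=D(1)=0$). Write $p(s)=P(S=s)$, $\pi_{D(a)}(s)=P(D(a)=1\mid S=s)$, $\Delta(s)=\pi_{D(1)}(s)-\pi_{D(0)}(s)$, $P(C)=\sum_s p(s)\Delta(s)$, $\beta=E[Y(1)-Y(0)\mid C]$ and $\beta(s)=E[Y(1)-Y(0)\mid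 C,S=s]$. Also let $n(s),n_A(s),n_D(s),n_{AD}(s)$ be the numbers of participants in stratum $s$, respectively those with $A_i=1$, with $D_i=1$, and with $A_i=D_i=1$. **Assumption 1.** $W^{(n)}$ is i.i.d. with a marginal distribution $Q$ that does not depend on $n$, and (a) $E[Y(d)^2]<\infty$ for $d\in\{0,1\}$; (b) $p(s)>0$ for all $s$; (c) $P(D(0)=1,D(1)=0)=0$; (d) $\Delta(s)>0$ for all $s$. **Assumption 3.** (a) $W^{(n)}\perp A^{(n)}\mid S^{(n)}$. (b) For some $\tau(s)\in[0,1]$, conditional on $S^{(n)}$, the vector $T_n=\{\sqrt n\,(n_A(s)/n(s)-\pi_A(s))\}_{s\in\mathcal S}$ converges in distribution to $N(0,\Sigma_A)$ with probability approaching one, where $\Sigma_A=\mathrm{diag}\{\tau(s)\pi_A(s)(1-\pi_A(s))/p(s):s\in\mathcal S\}$; that is, for every bounded continuous $f$ and every $\varepsilon>0$, $P\big(|E[f(T_n)\mid S^{(n)}]-\int f\,dN(0,\Sigma_A)|\le\varepsilon\big)\to1$. (c) $\pi_A(s)=\pi_A\in(0,1)$ for all $s$. **Asymptotic variance.** Let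 $a(s)=E[Y(1)\mid C,S=s]-E[Y(1)\mid AT,S=s]$ and $c(s)=E[Y(0)\mid C,S=s]-E[Y(0)\mid NT,S=s]$. Define $V_{\mathrm{sat}}=V_{Y,1}^{\mathrm{sat}}+V_{Y,0}^{\mathrm{sat}}+V_{D,1}^{\mathrm{sat}}+V_{D,0}^{\mathrm{sat}}+V_H^{\mathrm{sat}}$ with $$V_{Y,1}^{\mathrm{sat}}=\tfrac1{P(C)^2}\sum_s\tfrac{p(s)}{\pi_A(s)}\Big[V[Y(1)|AT,S=s]\pi_{D(0)}(s)+V[Y(0)|NT,S=s](1-\pi_{D(1)}(s))+V[Y(1)|C,S=s]\Delta(s)+a(s)^2\tfrac{\pi_{D(0)}(s)\Delta(s)}{\pi_{D(1)}(s)}\Big],$$ $$V_{Y,0}^{\mathrm{sat}}=\tfrac1{P(C)^2}\sum_s\tfrac{p(s)}{1-\pi_A(s)}\Big[V[Y(1)|AT,S=s]\pi_{D(0)}(s)+V[Y(0)|NT,S=s](1-\pi_{D(1)}(s))+V[Y(0)|C,S=s]\Delta(s)+c(s)^2\tfrac{(1-\pi_{D(1)}(s))\Delta(s)}{1-\pi_{D(0)}(s)}\Big],$$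 $$V_{D,1}^{\mathrm{sat}}=\tfrac1{P(C)^2}\sum_s\tfrac{p(s)(1-\pi_{D(1)}(s))}{\pi_A(s)\pi_{D(1)}(s)}\big[-\pi_{D(0)}(s)a(s)+\pi_{D(1)}(s)c(s)+\pi_{D(1)}(s)(\beta(s)-\beta)\big]^2,$$ $$V_{D,0}^{\mathrm{sat}}=\tfrac1{P(C)^2}\sum_s\tfrac{p(s)\pi_{D(0)}(s)}{(1-\pi_A(s))(1-\pi_{D(0)}(s))}\big[-(1-\pi_{D(0)}(s))a(s)+(1-\pi_{D(1)}(s))c(s)+(1-\pi_{D(0)}(s))(\beta(s)-\beta)\big]^2,$$ $$V_H^{\mathrm{sat}}=\tfrac1{P(C)^2}\sum_s p(s)\Delta(s)^2(\beta(s)-\beta)^2,$$ where conditional means and variances given a null event, which are always multiplied by zero, are set to $0$. Let $V_{\mathrm{sfe}}=V_{\mathrm{sat}}+V_A^{\mathrm{sfe}}$ with $$V_A^{\mathrm{sfe}}=\frac{(1-2\pi_A)^2}{P(C)^2\pi_A(1-\pi_A)}\sum_s p(s)\tau(s)\Delta(s)^2(\beta(s)-\beta)^2 .$$ **Estimator.**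 Let $\mathbf Y_n=(Y_i)_{i\le n}$, let $\mathbf X_n$ and $\mathbf Z_n$ have rows $(\{I\{S_i=s\}\}_s,\{D_iI\{S_i=s\}\}_s)$ and $(\{I\{S_i=s\}\}_s,\{A_iI\{S_i=s\}\}_s)$, and let $(\{\hat\gamma_{\mathrm{sat}}(s)\}_s,\{\hat\beta_{\mathrm{sat}}(s)\}_s)=(\mathbf Z_n'\mathbf X_n)^{-1}\mathbf Z_n'\mathbf Y_n$. Put $\hat\pi_1(s)=\frac{n_{AD}(s)}{n_A(s)}$, $\hat\pi_0(s)=\frac{n_D(s)-n_{AD}(s)}{n(s)-n_A(s)}$, $\hat P(C)=\sum_s\frac{n(s)}n(\hat\pi_1(s)-\hat\pi_0(s))$, $\hat\beta_{\mathrm{sat}}=\sum_s\frac{n(s)}{n}\frac{\hat\pi_1(s)-\hat\pi_0(s)}{\hat P(C)}\hat\beta_{\mathrm{sat}}(s)$, $\hat\delta(s)=\hat\beta_{\mathrm{sat}}(s)-\hat\beta_{\mathrm{sat}}$ and $\hat u_i=Y_i-\sum_sI\{S_i=s\}\hat\gamma_{\mathrm{sat}}(s)-\sum_sD_iI\{S_i=s\}\hat\beta_{\mathrm{sat}}(s)$.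 With $I_i(d,a,s)=I\{D_i=d,A_i=a,S_i=s\}$, define $\hat V_{\mathrm{sat}}=\hat V_1^{\mathrm{sat}}+\hat V_0^{\mathrm{sat}}+\hat V_H^{\mathrm{sat}}$ by $$\hat V_1^{\mathrm{sat}}=\tfrac1{\hat P(C)^2}\sum_s\Big(\tfrac{n(s)}{n_A(s)}\Big)^2\frac1n\sum_{i=1}^n\Big[I_i(1,1,s)\big(\hat u_i+(1-\hat\pi_1(s))\hat\delta(s)\big)^2+I_i(0,1,s)\big(\hat u_i-\hat\pi_1(s)\hat\delta(s)\big)^2\Big],$$ $$\hat V_0^{\mathrm{sat}}=\tfrac1{\hat P(C)^2}\sum_s\Big(\tfrac{n(s)}{n(s)-n_A(s)}\Big)^2\frac1n\sum_{i=1}^n\Big[I_i(1,0,s)\big(\hat u_i+(1-\hat\pi_0(s))\hat\delta(s)\big)^2+I_i(0,0,s)\big(\hat u_i-\hat\pi_0(s)\hat\delta(s)\big)^2\Big],$$ $$\hat V_H^{\mathrm{sat}}=\tfrac1{\hat P(C)^2}\sum_s\tfrac{n(s)}n(\hat\pi_1(s)-\hat\pi_0(s))^2\hat\delta(s)^2,$$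 and $$\hat V_A^{\mathrm{sfe}}=\tfrac1{\hat P(C)^2}\sum_s\tfrac{n(s)}n\,\tau(s)\,\frac{\big(1-2\frac{n_A(s)}{n(s)}\big)^2}{\frac{n_A(s)}{n(s)}\big(1-\frac{n_A(s)}{n(s)}\big)}\,(\hat\pi_1(s)-\hat\pi_0(s))^2\,\hat\delta(s)^2 .$$ Where a denominator vanishes the quotient is set to $0$, and where $\mathbf Z_n'\mathbf X_n$ is singular its inverse is set to the zero matrix. **Theorem.** Under Assumptions 1 and 3, $\hat V_{\mathrm{sfe}}=\hat V_{\mathrm{sat}}+\hat V_A^{\mathrm{sfe}}$ converges in probability to $V_{\mathrm{sfe}}$ as $n\to\infty$. -/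

import Mathlib

open MeasureTheory ProbabilityTheory Filter Topology
open scoped BoundedContinuousFunction Matrix

noncomputable section

namespace CARLate

/-! ### Population -/

/-- The underlying variables of one participant: the potential outcomes `d ↦ Y(d)`, the potential
treatment decisions `a ↦ D(a)` and the baseline covariates `Z`.  The values `1` and `0` of a
treatment decision or of a treatment assignment are encoded as `true` and `false`. -/
abbrev Primitive (Zc : Type*) : Type _ := (Bool → ℝ) × (Bool → Bool) × Zc

section Population

variable {Zc St : Type*}

/-- Potential outcome `Y(d)`. -/
def potY (d : Bool) (w : Primitive Zc) : ℝ := w.1 d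

/-- Potential treatment decision `D(a)`. -/
def potD (a : Bool) (w : Primitive Zc) : Bool := w.2.1 a

/-- Stratum `S(Z)`. -/
def stratum (S : Zc → St) (w : Primitive Zc) : St := S w.2.2

/-- The event `{S = s}`. -/
def inStratum (S : Zc → St) (s : St) : Set (Primitive Zc) := {w | stratum S w = s}

/-- Compliers: `D(0) = 0, D(1) = 1`. -/
def compliers : Set (Primitive Zc) := {w | potD false w = false ∧ potD true w = true}

/-- Always takers: `D(0) = D(1) = 1`. -/
def alwaysTakers : Set (Primitive Zc) := {w | potD false w = true ∧ potD true w = true}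

/-- Never takers: `D(0) = D(1) = 0`. -/
def neverTakers : Set (Primitive Zc) := {w | potD false w = false ∧ potD true w = false}

/-- Defiers: `D(0) = 1, D(1) = 0`. -/
def defiers : Set (Primitive Zc) := {w | potD false w = true ∧ potD true w = false}

variable [MeasurableSpace Zc]

/-- `E[f | B]` for an event `B`, under `Q` (equal to `0` if `Q B = 0`). -/
def condMean (Q : Measure (Primitive Zc)) (f : Primitive Zc → ℝ) (B : Set (Primitive Zc)) : ℝ :=
  ∫ w, f w ∂(ProbabilityTheory.cond Q B)

/-- `V[f | B]` for an event `B`, under `Q` (equal to `0` if `Q B = 0`). -/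
def condVar (Q : Measure (Primitive Zc)) (f : Primitive Zc → ℝ) (B : Set (Primitive Zc)) : ℝ :=
  ProbabilityTheory.variance f (ProbabilityTheory.cond Q B)

/-- `p(s) = P(S = s)`. -/
def p (Q : Measure (Primitive Zc)) (S : Zc → St) (s : St) : ℝ := Q.real (inStratum S s)

/-- `π_{D(a)}(s) = P(D(a) = 1 | S = s)`. -/
def piD (Q : Measure (Primitive Zc)) (S : Zc → St) (a : Bool) (s : St) : ℝ :=
  (ProbabilityTheory.cond Q (inStratum S s)).real {w | potD a w = true}

/-- The LATE `β = E[Y(1) - Y(0) | C]`. -/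
def late (Q : Measure (Primitive Zc)) : ℝ :=
  condMean Q (fun w => potY true w - potY false w) compliers

/-- The stratum-specific LATE `β(s) = E[Y(1) - Y(0) | C, S = s]`. -/
def lateIn (Q : Measure (Primitive Zc)) (S : Zc → St) (s : St) : ℝ :=
  condMean Q (fun w => potY true w - potY false w) (compliers ∩ inStratum S s)

/-- `E[Y(d) | T, S = s]` for a type `T` of participants. -/
def meanIn (Q : Measure (Primitive Zc)) (S : Zc → St) (d : Bool) (T : Set (Primitive Zc))
    (s : St) : ℝ :=
  condMean Q (potY d) (T ∩ inStratum S s)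

/-- `V[Y(d) | T, S = s]` for a type `T` of participants. -/
def varIn (Q : Measure (Primitive Zc)) (S : Zc → St) (d : Bool) (T : Set (Primitive Zc))
    (s : St) : ℝ :=
  condVar Q (potY d) (T ∩ inStratum S s)

variable [Fintype St]

/-- `P(C) = ∑ₛ p(s) (π_{D(1)}(s) - π_{D(0)}(s))`. -/
def probC (Q : Measure (Primitive Zc)) (S : Zc → St) : ℝ :=
  ∑ s, p Q S s * (piD Q S true s - piD Q S false s)

/-! ### Asymptotic variances -/

def VY1sat (Q : Measure (Primitive Zc)) (S : Zc → St) (piA : St → ℝ) : ℝ :=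
  1 / probC Q S ^ 2 * ∑ s, p Q S s / piA s *
    (varIn Q S true alwaysTakers s * piD Q S false s
      + varIn Q S false neverTakers s * (1 - piD Q S true s)
      + varIn Q S true compliers s * (piD Q S true s - piD Q S false s)
      + (meanIn Q S true compliers s - meanIn Q S true alwaysTakers s) ^ 2
        * (piD Q S false s * (piD Q S true s - piD Q S false s) / piD Q S true s))

def VY0sat (Q : Measure (Primitive Zc)) (S : Zc → St) (piA : St → ℝ) : ℝ :=
  1 / probC Q S ^ 2 * ∑ s, p Q S s / (1 - piA s) *
    (varIn Q S true alwaysTakers s * piD Q S false s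
      + varIn Q S false neverTakers s * (1 - piD Q S true s)
      + varIn Q S false compliers s * (piD Q S true s - piD Q S false s)
      + (meanIn Q S false compliers s - meanIn Q S false neverTakers s) ^ 2
        * ((1 - piD Q S true s) * (piD Q S true s - piD Q S false s) / (1 - piD Q S false s)))

def VD1sat (Q : Measure (Primitive Zc)) (S : Zc → St) (piA : St → ℝ) : ℝ :=
  1 / probC Q S ^ 2 * ∑ s, p Q S s * (1 - piD Q S true s) / (piA s * piD Q S true s) *
    (- piD Q S false s * (meanIn Q S true compliers s - meanIn Q S true alwaysTakers s)
      + piD Q S true s * (meanIn Q S false compliers s - meanIn Q S false neverTakers s)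
      + piD Q S true s * (lateIn Q S s - late Q)) ^ 2

def VD0sat (Q : Measure (Primitive Zc)) (S : Zc → St) (piA : St → ℝ) : ℝ :=
  1 / probC Q S ^ 2 * ∑ s, p Q S s * piD Q S false s / ((1 - piA s) * (1 - piD Q S false s)) *
    (- (1 - piD Q S false s) * (meanIn Q S true compliers s - meanIn Q S true alwaysTakers s)
      + (1 - piD Q S true s) * (meanIn Q S false compliers s - meanIn Q S false neverTakers s)
      + (1 - piD Q S false s) * (lateIn Q S s - late Q)) ^ 2

def VHsat (Q : Measure (Primitive Zc)) (S : Zc → St) : ℝ :=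
  1 / probC Q S ^ 2 * ∑ s, p Q S s * (piD Q S true s - piD Q S false s) ^ 2
    * (lateIn Q S s - late Q) ^ 2

/-- `V_sat`. -/
def Vsat (Q : Measure (Primitive Zc)) (S : Zc → St) (piA : St → ℝ) : ℝ :=
  VY1sat Q S piA + VY0sat Q S piA + VD1sat Q S piA + VD0sat Q S piA + VHsat Q S

/-- `V_A^sfe`, for a treatment propensity `pi0` that does not vary by strata. -/
def VAsfe (Q : Measure (Primitive Zc)) (S : Zc → St) (pi0 : ℝ) (tau : St → ℝ) : ℝ :=
  (1 - 2 * pi0) ^ 2 / (probC Q S ^ 2 * pi0 * (1 - pi0)) *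
    ∑ s, p Q S s * tau s * (piD Q S true s - piD Q S false s) ^ 2 * (lateIn Q S s - late Q) ^ 2

/-- `V_sfe = V_sat + V_A^sfe`. -/
def Vsfe (Q : Measure (Primitive Zc)) (S : Zc → St) (piA : St → ℝ) (pi0 : ℝ) (tau : St → ℝ) : ℝ :=
  Vsat Q S piA + VAsfe Q S pi0 tau

end Population

/-! ### Observed data and estimators -/

/-- What the estimators use of the observed data of `n` participants:
outcomes, treatment decisions, treatment assignments and strata. -/
structure Obs (n : ℕ) (St : Type*) where
  Y : Fin n → ℝ
  D : Fin n → Bool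
  A : Fin n → Bool
  S : Fin n → St

/-- Observed data: `D_i = D_i(A_i)`, `Y_i = Y_i(D_i)`, `S_i = S(Z_i)`. -/
def observe {Zc St : Type*} {n : ℕ} (S : Zc → St) (W : Fin n → Primitive Zc) (A : Fin n → Bool) :
    Obs n St where
  Y i := potY (potD (A i) (W i)) (W i)
  D i := potD (A i) (W i)
  A := A
  S i := stratum S (W i)

/-- The number `0` or `1` encoded by a Boolean. -/
def num (b : Bool) : ℝ := if b = true then 1 else 0

namespace Obs

variable {n : ℕ} {St : Type*} [DecidableEq St] (X : Obs n St)

/-- `I{S_i = s}`. -/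
def ind (i : Fin n) (s : St) : ℝ := if X.S i = s then 1 else 0

/-- `n(s)`. -/
def nS (s : St) : ℝ := ∑ i, if X.S i = s then 1 else 0

/-- `n_A(s)`. -/
def nA (s : St) : ℝ := ∑ i, if X.A i = true ∧ X.S i = s then 1 else 0

/-- `n_D(s)`. -/
def nD (s : St) : ℝ := ∑ i, if X.D i = true ∧ X.S i = s then 1 else 0

/-- `n_{AD}(s)`. -/
def nAD (s : St) : ℝ := ∑ i, if X.A i = true ∧ X.D i = true ∧ X.S i = s then 1 else 0

/-- `n_{AD}(s) / n_A(s)`, the empirical counterpart of `π_{D(1)}(s)`. -/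
def piD1hat (s : St) : ℝ := X.nAD s / X.nA s

/-- `(n_D(s) - n_{AD}(s)) / (n(s) - n_A(s))`, the empirical counterpart of `π_{D(0)}(s)`. -/
def piD0hat (s : St) : ℝ := (X.nD s - X.nAD s) / (X.nS s - X.nA s)

/-- The regressors of the fully saturated IV regression. -/
def Xsat : Matrix (Fin n) (St ⊕ St) ℝ :=
  Matrix.of fun i => Sum.elim (fun s => X.ind i s) (fun s => num (X.D i) * X.ind i s)

/-- The instruments of the fully saturated IV regression. -/
def Zsat : Matrix (Fin n) (St ⊕ St) ℝ :=
  Matrix.of fun i => Sum.elim (fun s => X.ind i s) (fun s => num (X.A i) * X.ind i s)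

variable [Fintype St]

/-- The IV coefficients `(Z'X)⁻¹ (Z'Y)` of the fully saturated regression. -/
def coefSat : St ⊕ St → ℝ := (X.Zsatᵀ * X.Xsat)⁻¹ *ᵥ (X.Zsatᵀ *ᵥ X.Y)

/-- `γ̂_sat(s)`. -/
def gammaSatHat (s : St) : ℝ := X.coefSat (Sum.inl s)

/-- `β̂_sat(s)`. -/
def betaSatIn (s : St) : ℝ := X.coefSat (Sum.inr s)

/-- `P̂(S = s, C)`. -/
def probSCHat (s : St) : ℝ := X.nS s / n * (X.piD1hat s - X.piD0hat s)

/-- `P̂(C)`. -/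
def probCHat : ℝ := ∑ s, X.nS s / n * (X.piD1hat s - X.piD0hat s)

/-- `β̂_sat = ∑ₛ P̂(S = s | C) β̂_sat(s)`. -/
def betaSat : ℝ := ∑ s, X.probSCHat s / X.probCHat * X.betaSatIn s

/-- The residual `û_i` of the fully saturated IV regression. -/
def resid (i : Fin n) : ℝ :=
  X.Y i - ∑ s, X.ind i s * X.gammaSatHat s - ∑ s, num (X.D i) * X.ind i s * X.betaSatIn s

/-- `(1/n) ∑ᵢ I{D_i = d, A_i = a, S_i = s} (û_i + c)²`. -/
def cellSq (d a : Bool) (s : St) (c : ℝ) : ℝ :=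
  1 / n * ∑ i, if X.D i = d ∧ X.A i = a ∧ X.S i = s then (X.resid i + c) ^ 2 else 0

/-- `V̂_1^sat`. -/
def V1satHat : ℝ :=
  1 / X.probCHat ^ 2 * ∑ s, (X.nS s / X.nA s) ^ 2 *
    (X.cellSq true true s ((1 - X.piD1hat s) * (X.betaSatIn s - X.betaSat))
      + X.cellSq false true s (- (X.piD1hat s * (X.betaSatIn s - X.betaSat))))

/-- `V̂_0^sat`. -/
def V0satHat : ℝ :=
  1 / X.probCHat ^ 2 * ∑ s, (X.nS s / (X.nS s - X.nA s)) ^ 2 *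
    (X.cellSq true false s ((1 - X.piD0hat s) * (X.betaSatIn s - X.betaSat))
      + X.cellSq false false s (- (X.piD0hat s * (X.betaSatIn s - X.betaSat))))

/-- `V̂_H^sat`. -/
def VHsatHat : ℝ :=
  1 / X.probCHat ^ 2 * ∑ s, X.nS s / n * (X.piD1hat s - X.piD0hat s) ^ 2
    * (X.betaSatIn s - X.betaSat) ^ 2

/-- `V̂_sat`. -/
def VsatHat : ℝ := X.V1satHat + X.V0satHat + X.VHsatHat

/-- `V̂_A^sfe`, which uses the known function `tau`. -/
def VAsfeHat (tau : St → ℝ) : ℝ :=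
  1 / X.probCHat ^ 2 * ∑ s, X.nS s / n * tau s
    * ((1 - 2 * (X.nA s / X.nS s)) ^ 2 / (X.nA s / X.nS s * (1 - X.nA s / X.nS s)))
    * (X.piD1hat s - X.piD0hat s) ^ 2 * (X.betaSatIn s - X.betaSat) ^ 2

/-- `V̂_sfe = V̂_sat + V̂_A^sfe`. -/
def VsfeHat (tau : St → ℝ) : ℝ := X.VsatHat + X.VAsfeHat tau

end Obs

/-! ### Assumptions -/

section Assumptions

variable {Zc St : Type*} [MeasurableSpace Zc] {Ω : ℕ → Type*} [∀ n, MeasurableSpace (Ω n)]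

/-- For every sample size `n`, `W^(n)` is an i.i.d. sample with marginal distribution `Q`, and `Q`
satisfies (a) finite second moments, (b) all strata are relevant, (c) no defiers and
(d) compliers in every stratum. -/
structure SamplingAssumption (P : ∀ n, Measure (Ω n)) (W : ∀ n, Fin n → Ω n → Primitive Zc)
    (Q : Measure (Primitive Zc)) (S : Zc → St) : Prop where
  measurable : ∀ n i, Measurable (W n i)
  indep : ∀ n, iIndepFun (W n) (P n)
  law : ∀ n i, (P n).map (W n i) = Q
  secondMoment : ∀ d, Integrable (fun w => potY d w ^ 2) Q
  strata_pos : ∀ s, 0 < p Q S s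
  no_defiers : Q defiers = 0
  compliers_pos : ∀ s, 0 < piD Q S true s - piD Q S false s

/-- The vector of strata `S^(n)`. -/
def strataVec (S : Zc → St) (W : ∀ n, Fin n → Ω n → Primitive Zc) (n : ℕ) (ω : Ω n) : Fin n → St :=
  fun i => stratum S (W n i ω)

/-- The event that the vector of strata `S^(n)` equals `σ`. -/
def strataEvent (S : Zc → St) (W : ∀ n, Fin n → Ω n → Primitive Zc) (n : ℕ) (σ : Fin n → St) :
    Set (Ω n) := {ω | strataVec S W n ω = σ}

/-- The observed data of sample size `n`. -/
def data (S : Zc → St) (W : ∀ n, Fin n → Ω n → Primitive Zc) (A : ∀ n, Fin n → Ω n → Bool)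
    (n : ℕ) (ω : Ω n) : Obs n St :=
  observe S (fun i => W n i ω) (fun i => A n i ω)

/-- The vector `(√n (n_A(s)/n(s) - π_A(s)) : s)`. -/
def imbalance [DecidableEq St] (S : Zc → St) (W : ∀ n, Fin n → Ω n → Primitive Zc)
    (A : ∀ n, Fin n → Ω n → Bool) (piA : St → ℝ) (n : ℕ) (ω : Ω n) : EuclideanSpace ℝ St :=
  WithLp.toLp 2 fun s =>
    Real.sqrt n * ((data S W A n ω).nA s / (data S W A n ω).nS s - piA s)

/-- `Σ_A = diag (τ(s) π_A(s) (1 - π_A(s)) / p(s) : s)`. -/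
def SigmaA [DecidableEq St] (Q : Measure (Primitive Zc)) (S : Zc → St) (piA tau : St → ℝ) :
    Matrix St St ℝ :=
  Matrix.diagonal fun s => tau s * piA s * (1 - piA s) / p Q S s

/-- The conditional distribution of the random vector `T n` given the vector of strata `S^(n)`
converges weakly to `ν` with probability approaching one: for every bounded continuous `f`,
`E[f(T n) | S^(n)]` lies within `ε` of `∫ f dν` with probability approaching one.
As `S^(n)` takes finitely many values, the conditional expectation at `ω` is the expectation
given the event that `S^(n)` takes its value at `ω`. -/
def CondWeakConv {E : Type*} [TopologicalSpace E] [MeasurableSpace E] (P : ∀ n, Measure (Ω n))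
    (S : Zc → St) (W : ∀ n, Fin n → Ω n → Primitive Zc) (T : ∀ n, Ω n → E) (ν : Measure E) : Prop :=
  ∀ f : E →ᵇ ℝ, ∀ ε : ℝ, 0 < ε →
    Tendsto (fun n => (P n).real {ω |
      |∫ ω', f (T n ω') ∂(ProbabilityTheory.cond (P n) (strataEvent S W n (strataVec S W n ω)))
        - ∫ x, f x ∂ν| ≤ ε}) atTop (𝓝 1)

/-- The treatment assignment mechanism satisfies (a) `W^(n)` and `A^(n)` are independent conditional
on `S^(n)`, i.e. given each value of this finitely-valued vector, (b) conditional asymptotic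
normality of the treatment proportions with the dispersion parameters `τ(s) ∈ [0,1]`, and
(c) a target proportion `pi0` in `(0,1)` that does not vary by strata. -/
structure AssignmentAssumption [Fintype St] [DecidableEq St] (P : ∀ n, Measure (Ω n))
    (W : ∀ n, Fin n → Ω n → Primitive Zc) (A : ∀ n, Fin n → Ω n → Bool)
    (Q : Measure (Primitive Zc)) (S : Zc → St) (piA tau : St → ℝ) (pi0 : ℝ) : Prop where
  measurable : ∀ n i, Measurable (A n i)
  cond_indep : ∀ n (σ : Fin n → St),
    IndepFun (fun ω i => W n i ω) (fun ω i => A n i ω)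
      (ProbabilityTheory.cond (P n) (strataEvent S W n σ))
  tau_mem : ∀ s, tau s ∈ Set.Icc (0 : ℝ) 1
  cond_normal : CondWeakConv P S W (imbalance S W A piA)
    (multivariateGaussian 0 (SigmaA Q S piA tau))
  const_target : ∀ s, piA s = pi0
  target_mem : pi0 ∈ Set.Ioo (0 : ℝ) 1

/-- Convergence in probability of `T n`, defined on the `n`-th probability space, to a constant. -/
def TendstoInProb (P : ∀ n, Measure (Ω n)) (T : ∀ n, Ω n → ℝ) (c : ℝ) : Prop :=
  ∀ ε : ℝ, 0 < ε → Tendsto (fun n => (P n).real {ω | ε ≤ |T n ω - c|}) atTop (𝓝 0)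

end Assumptions

end CARLate

end

open MeasureTheory ProbabilityTheory Filter Topology
open scoped BoundedContinuousFunction Matrix

noncomputable section

set_option linter.unusedSectionVars false

/-! The estimator is a continuous function of finitely many sample averages, so it suffices to find
the limits of these averages and to recognise the same function of the limits as the asymptotic
variance.

The averages are the cell moments `(1/n) ∑ I{D = d, A = a, S = s} Y ^ k` with `k ≤ 2`. The saturated
regression decouples into one 2 × 2 system per stratum, so its coefficients are given by Cramer's
rule, and expanding the squared residuals leaves only cell moments (`Obs.coefSat_eq`,
`Obs.cellSq_eq`). In arm `a` the observed `Y ^ k I{D = d}` equals `Y(d) ^ k I{D(a) = d}`, a function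
of `W_i` alone. What is needed is thus a law of large numbers for `f(W_i) I{A_i = a, S_i = s}` with
`f` merely integrable, because `Y ^ 2` has no further moments (`tendsto_armAverage`). Write `f` as
its stratum mean plus a deviation. Given the strata, the deviations are independent, centered and
independent of the assignment, so after truncation the summands are bounded and orthogonal and their
average is `O(1/√n)` in `L¹`. The mean part reduces to `n_A(s)/n(s) → π_A`, and here conditional
normality enters only through tightness of its limit (`tendsto_nA_div_nS`).

For the limit, put `δ(s) = β(s) - β`. The limiting summand in arm `a` is the square of `Y - γ(s) - D
β(s) + (D - π_{D(a)}(s)) δ(s)`, which has mean zero in the arm and differs from `Y - β D` by a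
constant. The arm therefore contributes `V[Y - β D | A = a, S = s]`. The law of total variance over
`D` splits this into the bracket of `V_{Y,a}` (within `D`, a mixture of types) and that of `V_{D,a}`
(between `D = 1` and `D = 0`); see `limitCells_armVar_true` and `limitCells_armVar_false`. The
remaining two terms pass to the limit directly. -/

namespace CARLate

/-! ### Convergence in probability as convergence along a filter -/

section ProbFilter

variable {Ω : ℕ → Type*} [∀ n, MeasurableSpace (Ω n)]

/-- The filter of the families of events whose probability tends to one. -/
def probFilter (P : ∀ n, Measure (Ω n)) [∀ n, IsProbabilityMeasure (P n)] :
    Filter (Σ n, Ω n) where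
  sets := {E | Tendsto (fun n => (P n).real {ω | (⟨n, ω⟩ : Σ n, Ω n) ∉ E}) atTop (𝓝 0)}
  univ_sets := by simp
  sets_of_superset := by
    intro E F hE hEF
    refine squeeze_zero (fun _ => measureReal_nonneg) (fun n => ?_) hE
    exact measureReal_mono (fun ω hω hE => hω (hEF hE))
  inter_sets := by
    intro E F hE hF
    have h := Tendsto.add hE hF
    rw [add_zero] at h
    refine squeeze_zero (fun _ => measureReal_nonneg) (fun n => ?_) h
    refine (measureReal_mono ?_).trans (measureReal_union_le _ _)
    intro ω hω
    by_contra hc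
    simp only [Set.mem_union, Set.mem_ofPred_eq, not_or, not_not] at hc
    exact hω hc

variable (P : ∀ n, Measure (Ω n)) [∀ n, IsProbabilityMeasure (P n)]

theorem eventually_probFilter {p : (Σ n, Ω n) → Prop} :
    (∀ᶠ x in probFilter P, p x) ↔
      Tendsto (fun n => (P n).real {ω | ¬ p ⟨n, ω⟩}) atTop (𝓝 0) := Iff.rfl

/-- With this, Slutsky's lemma and the continuous mapping theorem become the usual algebra of
`Tendsto`, although the probability space changes with `n`. -/
theorem tendstoInProb_iff {T : ∀ n, Ω n → ℝ} {c : ℝ} :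
    TendstoInProb P T c ↔ Tendsto (fun x : Σ n, Ω n => T x.1 x.2) (probFilter P) (𝓝 c) := by
  rw [Metric.tendsto_nhds]
  simp only [eventually_probFilter, Real.dist_eq, not_lt, TendstoInProb]

theorem eventually_probFilter_of_atTop {p : ℕ → Prop} (h : ∀ᶠ n in atTop, p n) :
    ∀ᶠ x in probFilter P, p x.1 := by
  rw [eventually_probFilter]
  refine tendsto_const_nhds.congr' ?_
  filter_upwards [h] with n hn
  simp [hn]

/-- Markov's inequality. -/
theorem tendstoInProb_of_integral_abs {T : ∀ n, Ω n → ℝ} {c : ℝ}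
    (hint : ∀ n, Integrable (fun ω => T n ω - c) (P n))
    (h : Tendsto (fun n => ∫ ω, |T n ω - c| ∂(P n)) atTop (𝓝 0)) : TendstoInProb P T c := by
  intro ε hε
  have h' := h.const_mul ε⁻¹
  rw [mul_zero] at h'
  refine squeeze_zero (fun _ => measureReal_nonneg) (fun n => ?_) h'
  rw [inv_mul_eq_div, le_div_iff₀' hε]
  exact mul_meas_ge_le_integral_of_nonneg (Eventually.of_forall fun _ => abs_nonneg _)
    (hint n).abs ε

end ProbFilter

/-! ### Averages of bounded orthogonal variables -/

section Orthogonal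

variable {Ω : Type*} [MeasurableSpace Ω] {μ : Measure Ω} [IsProbabilityMeasure μ]

/-- The variance of `|Z|` is nonnegative. -/
theorem integral_abs_sq_le {Z : Ω → ℝ} (hZ : MemLp Z 2 μ) :
    (∫ ω, |Z ω| ∂μ) ^ 2 ≤ ∫ ω, Z ω ^ 2 ∂μ := by
  have h := variance_eq_sub (μ := μ) hZ.abs
  have h0 := variance_nonneg (fun ω => |Z ω|) μ
  have h1 : ∫ ω, ((fun ω => |Z ω|) ^ 2) ω ∂μ = ∫ ω, Z ω ^ 2 ∂μ := by simp
  change variance (fun ω => |Z ω|) μ = _ - (∫ ω, |Z ω| ∂μ) ^ 2 at h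
  have h2 : ∫ ω, ((|Z|) ^ 2) ω ∂μ = ∫ ω, Z ω ^ 2 ∂μ := by simp
  rw [h2] at h
  linarith

/-- The `L¹` norm is at most the `L²` norm; in the squared sum orthogonality leaves the `n` diagonal
terms, each at most `K ^ 2`. -/
theorem integral_abs_average_le {n : ℕ} {X : Fin n → Ω → ℝ} {K : ℝ} (hK : 0 ≤ K)
    (hm : ∀ i, Measurable (X i)) (hb : ∀ i ω, |X i ω| ≤ K)
    (ho : ∀ i j, i ≠ j → ∫ ω, X i ω * X j ω ∂μ = 0) :
    ∫ ω, |1 / (n : ℝ) * ∑ i, X i ω| ∂μ ≤ K / Real.sqrt n := by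
  have hL : ∀ i, MemLp (X i) 2 μ := fun i =>
    MemLp.of_bound (hm i).aestronglyMeasurable K (Eventually.of_forall (hb i))
  have hZ : MemLp (fun ω => 1 / (n : ℝ) * ∑ i, X i ω) 2 μ :=
    (memLp_finsetSum _ fun i _ => hL i).const_mul _
  rcases Nat.eq_zero_or_pos n with rfl | hn
  · simp
  have hn' : (0 : ℝ) < n := by exact_mod_cast hn
  refine abs_le_of_sq_le_sq' ?_ (by positivity) |>.2
  refine (integral_abs_sq_le hZ).trans ?_
  have hij : ∀ i j, Integrable (fun ω => X i ω * X j ω) μ := fun i j =>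
    (hL i).integrable_mul (hL j)
  have hsq : ∀ i, ∫ ω, X i ω * X i ω ∂μ ≤ K ^ 2 := by
    intro i
    have : ∫ ω, X i ω * X i ω ∂μ ≤ ∫ _, K ^ 2 ∂μ := by
      refine integral_mono (hij i i) (integrable_const _) fun ω => ?_
      have := hb i ω
      nlinarith [abs_mul_abs_self (X i ω), abs_nonneg (X i ω)]
    simpa using this
  have hexp : ∫ ω, (1 / (n : ℝ) * ∑ i, X i ω) ^ 2 ∂μ
      = 1 / (n : ℝ) ^ 2 * ∑ i, ∑ j, ∫ ω, X i ω * X j ω ∂μ := by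
    simp_rw [mul_pow, pow_two (∑ i, X i _), Finset.sum_mul_sum]
    rw [integral_const_mul, integral_finsetSum _ fun i _ => integrable_finsetSum _ fun j _ => hij i j]
    simp_rw [integral_finsetSum _ fun j _ => hij _ j]
    rw [one_div_pow]
  rw [hexp]
  have hdiag : ∀ i, ∑ j, ∫ ω, X i ω * X j ω ∂μ ≤ K ^ 2 := by
    intro i
    rw [Finset.sum_eq_single i (fun j _ hj => ho i j (Ne.symm hj)) (by simp)]
    exact hsq i
  have hsum : ∑ i, ∑ j, ∫ ω, X i ω * X j ω ∂μ ≤ n * K ^ 2 := by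
    refine (Finset.sum_le_sum fun i _ => hdiag i).trans ?_
    simp
  rw [div_pow, Real.sq_sqrt hn'.le, one_div, inv_mul_le_iff₀ (by positivity)]
  calc _ ≤ _ := hsum
    _ = _ := by field_simp

/-- For a null event both sides vanish, so events may be conditioned on without checking that they
have positive probability. -/
theorem setIntegral_eq_real_mul_cond {E : Set Ω} (f : Ω → ℝ) :
    ∫ ω in E, f ω ∂μ = μ.real E * ∫ ω, f ω ∂(ProbabilityTheory.cond μ E) := by
  by_cases h : μ E = 0
  · simp [Measure.restrict_eq_zero.2 h, Measure.real, h]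
  · have h' : μ.real E ≠ 0 := by
      simp [Measure.real, ENNReal.toReal_eq_zero_iff, h]
    rw [ProbabilityTheory.cond, integral_smul_measure, ENNReal.toReal_inv, smul_eq_mul,
      ← mul_assoc]
    change _ = μ.real E * (μ.real E)⁻¹ * _
    rw [mul_inv_cancel₀ h', one_mul]

end Orthogonal

/-! ### Laws of large numbers for the sampling scheme -/

section LLN

variable {Zc St : Type*} [MeasurableSpace Zc] [Fintype St] [DecidableEq St]
  [MeasurableSpace St] [MeasurableSingletonClass St]

theorem measurable_potY (d : Bool) : Measurable (potY (Zc := Zc) d) :=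
  (measurable_pi_apply d).comp measurable_fst

theorem measurable_potD (a : Bool) : Measurable (potD (Zc := Zc) a) :=
  (measurable_pi_apply a).comp (measurable_fst.comp measurable_snd)

theorem measurable_stratum {S : Zc → St} (hS : Measurable S) : Measurable (stratum S) :=
  hS.comp (measurable_snd.comp measurable_snd)

theorem measurableSet_inStratum {S : Zc → St} (hS : Measurable S) (s : St) :
    MeasurableSet (inStratum S s) :=
  measurable_stratum hS (measurableSet_singleton s)

/-- The deviation of `f` from its mean in stratum `s`, inside this stratum. -/
def center (Q : Measure (Primitive Zc)) (S : Zc → St) (s : St) (f : Primitive Zc → ℝ) :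
    Primitive Zc → ℝ :=
  (inStratum S s).indicator fun w => f w - (∫ w in inStratum S s, f w ∂Q) / p Q S s

variable {Q : Measure (Primitive Zc)} [IsProbabilityMeasure Q] {S : Zc → St}

theorem measurable_center (hS : Measurable S) (s : St) {f : Primitive Zc → ℝ}
    (hf : Measurable f) : Measurable (center Q S s f) :=
  (hf.sub_const _).indicator (measurableSet_inStratum hS s)

theorem integrable_center (hS : Measurable S) (s : St) {f : Primitive Zc → ℝ}
    (hf : Integrable f Q) : Integrable (center Q S s f) Q :=
  (hf.sub (integrable_const _)).indicator (measurableSet_inStratum hS s)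

/-- The integral vanishes over every stratum, not just over `s`: this is mean zero conditionally on
the stratum, as the orthogonality argument requires. -/
theorem setIntegral_center (hS : Measurable S) {s : St} (hs : 0 < p Q S s)
    {f : Primitive Zc → ℝ} (hf : Integrable f Q) (t : St) :
    ∫ w in inStratum S t, center Q S s f w ∂Q = 0 := by
  by_cases hst : t = s
  · subst hst
    rw [center, setIntegral_indicator (measurableSet_inStratum hS t), Set.inter_self,
      integral_sub hf.integrableOn (integrable_const _)]
    simp only [integral_const, smul_eq_mul, measureReal_restrict_apply_univ]
    change _ - p Q S t * _ = 0
    field_simp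
    simp
  · refine setIntegral_eq_zero_of_forall_eq_zero fun w hw => ?_
    refine Set.indicator_of_notMem (fun hw' => hst ?_) _
    exact Eq.trans (Eq.symm hw) hw'

theorem center_sub (s : St) {f g : Primitive Zc → ℝ} (hf : Integrable f Q)
    (hg : Integrable g Q) (w : Primitive Zc) :
    center Q S s (fun w => f w - g w) w = center Q S s f w - center Q S s g w := by
  by_cases hw : w ∈ inStratum S s
  · simp only [center, Set.indicator_of_mem hw]
    rw [integral_sub hf.integrableOn hg.integrableOn]
    ring
  · simp only [center, Set.indicator_of_notMem hw, sub_zero]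

/-- The subtracted mean costs at most another `∫ |f|`, whence the factor 2. -/
theorem integral_abs_center_le (hS : Measurable S) {s : St} (hs : 0 < p Q S s)
    {f : Primitive Zc → ℝ} (hf : Integrable f Q) :
    ∫ w, |center Q S s f w| ∂Q ≤ 2 * ∫ w, |f w| ∂Q := by
  have h1 : ∫ w, |center Q S s f w| ∂Q
      = ∫ w in inStratum S s, |f w - (∫ w in inStratum S s, f w ∂Q) / p Q S s| ∂Q := by
    rw [← integral_indicator (measurableSet_inStratum hS s)]
    congr 1
    ext w
    by_cases hw : w ∈ inStratum S s <;> simp [center, hw]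
  have h2 : ∫ w in inStratum S s, |f w - (∫ w in inStratum S s, f w ∂Q) / p Q S s| ∂Q
      ≤ ∫ w in inStratum S s, (|f w| + |(∫ w in inStratum S s, f w ∂Q) / p Q S s|) ∂Q :=
    integral_mono ((hf.integrableOn.sub (integrable_const _)).abs)
      (hf.integrableOn.abs.add (integrable_const _)) fun w => abs_sub _ _
  rw [h1]
  refine h2.trans ?_
  rw [integral_add hf.integrableOn.abs (integrable_const _)]
  simp only [integral_const, smul_eq_mul, measureReal_restrict_apply_univ]
  have h3 : Q.real (inStratum S s) * |(∫ w in inStratum S s, f w ∂Q) / p Q S s|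
      = |∫ w in inStratum S s, f w ∂Q| := by
    change p Q S s * _ = _
    rw [abs_div, abs_of_pos hs]
    field_simp
  rw [h3]
  have h4 : |∫ w in inStratum S s, f w ∂Q| ≤ ∫ w in inStratum S s, |f w| ∂Q :=
    abs_integral_le_integral_abs
  have h5 : ∫ w in inStratum S s, |f w| ∂Q ≤ ∫ w, |f w| ∂Q :=
    setIntegral_le_integral hf.abs (Eventually.of_forall fun _ => abs_nonneg _)
  linarith

theorem exists_bound_center (s : St) {f : Primitive Zc → ℝ} {K : ℝ}
    (hf : ∀ w, |f w| ≤ K) : ∃ C, 0 ≤ C ∧ ∀ w, |center Q S s f w| ≤ C := by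
  refine ⟨|K| + |(∫ w in inStratum S s, f w ∂Q) / p Q S s|, by positivity, fun w => ?_⟩
  by_cases hw : w ∈ inStratum S s
  · simp only [center, Set.indicator_of_mem hw]
    exact (abs_sub _ _).trans (add_le_add ((hf w).trans (le_abs_self K)) le_rfl)
  · simp only [center, Set.indicator_of_notMem hw, abs_zero]
    positivity

/-- Truncation of `f` to the level `K`. -/
def cutoff (K : ℕ) (f : Primitive Zc → ℝ) : Primitive Zc → ℝ :=
  fun w => if |f w| ≤ K then f w else 0

theorem measurable_cutoff (K : ℕ) {f : Primitive Zc → ℝ} (hf : Measurable f) :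
    Measurable (cutoff K f) :=
  Measurable.ite (measurableSet_le hf.abs measurable_const) hf measurable_const

theorem abs_cutoff_le (K : ℕ) (f : Primitive Zc → ℝ) (w : Primitive Zc) :
    |cutoff K f w| ≤ K := by
  unfold cutoff
  split_ifs with h
  · exact h
  · simp

theorem integrable_cutoff (K : ℕ) {f : Primitive Zc → ℝ} (hf : Measurable f) :
    Integrable (cutoff K f) Q :=
  Integrable.of_bound (measurable_cutoff K hf).aestronglyMeasurable K
    (Eventually.of_forall (abs_cutoff_le K f))

theorem tendsto_integral_abs_sub_cutoff {f : Primitive Zc → ℝ} (hf : Measurable f)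
    (hfi : Integrable f Q) :
    Tendsto (fun K : ℕ => ∫ w, |f w - cutoff K f w| ∂Q) atTop (𝓝 0) := by
  rw [← integral_zero (Primitive Zc) ℝ (μ := Q)]
  refine tendsto_integral_of_dominated_convergence (fun w => |f w|)
    (fun K => (hf.sub (measurable_cutoff K hf)).abs.aestronglyMeasurable) hfi.abs
    (fun K => Eventually.of_forall fun w => ?_) (Eventually.of_forall fun w => ?_)
  · unfold cutoff
    split_ifs <;> simp
  · refine tendsto_const_nhds.congr' ?_
    filter_upwards [eventually_ge_atTop ⌈|f w|⌉₊] with K hK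
    have : |f w| ≤ K := Nat.ceil_le.1 hK
    simp [cutoff, this]

/-! ### Orthogonality given the strata, and averages over a treatment arm -/

variable {Ω : ℕ → Type*} [∀ n, MeasurableSpace (Ω n)] {P : ∀ n, Measure (Ω n)}
  [∀ n, IsProbabilityMeasure (P n)] {W : ∀ n, Fin n → Ω n → Primitive Zc}
  {A : ∀ n, Fin n → Ω n → Bool}

theorem measurableSet_strataEvent (hS : Measurable S) (hW : ∀ n i, Measurable (W n i)) (n : ℕ)
    (σ : Fin n → St) : MeasurableSet (strataEvent S W n σ) := by
  have : Measurable (strataVec S W n) :=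
    measurable_pi_lambda _ fun i => (measurable_stratum hS).comp (hW n i)
  exact this (measurableSet_singleton σ)

/-- Total expectation over the finitely many values of the strata vector. -/
theorem integral_eq_sum_cond (hS : Measurable S) (hW : ∀ n i, Measurable (W n i)) (n : ℕ)
    {f : Ω n → ℝ} (hf : Integrable f (P n)) :
    ∫ ω, f ω ∂(P n) = ∑ σ, (P n).real (strataEvent S W n σ)
      * ∫ ω, f ω ∂(ProbabilityTheory.cond (P n) (strataEvent S W n σ)) := by
  simp_rw [← setIntegral_eq_real_mul_cond]
  rw [← integral_iUnion_fintype (measurableSet_strataEvent hS hW n) ?_ fun _ => hf.integrableOn]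
  · rw [show (⋃ σ, strataEvent S W n σ) = Set.univ from
      Set.eq_univ_of_forall fun ω => Set.mem_iUnion.2 ⟨_, rfl⟩, setIntegral_univ]
  · intro σ τ hστ
    exact Set.disjoint_left.2 fun ω h1 h2 => hστ (Eq.trans (Eq.symm h1) h2)

/-- The event is the intersection of the events `S_k = σ k`, so by independence the integral factors
over participants, and the factor of `i` is the integral of `h` over a stratum. -/
theorem setIntegral_strataEvent_mul_eq_zero (hS : Measurable S)
    (h1 : SamplingAssumption P W Q S) {n : ℕ} {h : Primitive Zc → ℝ} (hm : Measurable h)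
    (h0 : ∀ t, ∫ w in inStratum S t, h w ∂Q = 0) {i j : Fin n} (hij : i ≠ j) (σ : Fin n → St) :
    ∫ ω in strataEvent S W n σ, h (W n i ω) * h (W n j ω) ∂(P n) = 0 := by
  -- Every participant carries the indicator of the prescribed stratum; only `i` and `j` carry `h`
  -- as well.
  let F : Fin n → Primitive Zc → ℝ := fun k => (inStratum S (σ k)).indicator
    fun w => (if k = i then h w else 1) * (if k = j then h w else 1)
  have hFm : ∀ k, Measurable (F k) := by
    intro k
    refine Measurable.indicator (Measurable.mul ?_ ?_) (measurableSet_inStratum hS _)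
    · split_ifs
      · exact hm
      · exact measurable_const
    · split_ifs
      · exact hm
      · exact measurable_const
  have hprod : ∀ ω, ∏ k, F k (W n k ω)
      = (strataEvent S W n σ).indicator (fun ω => h (W n i ω) * h (W n j ω)) ω := by
    intro ω
    by_cases hω : ω ∈ strataEvent S W n σ
    · rw [Set.indicator_of_mem hω]
      have : ∀ k, F k (W n k ω)
          = (if k = i then h (W n k ω) else 1) * (if k = j then h (W n k ω) else 1) :=
        fun k => Set.indicator_of_mem (show W n k ω ∈ inStratum S (σ k) from congrFun hω k) _
      simp_rw [this, Finset.prod_mul_distrib]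
      simp
    · rw [Set.indicator_of_notMem hω]
      have : ∃ k, stratum S (W n k ω) ≠ σ k := by
        by_contra hc
        push Not at hc
        exact hω (funext hc)
      obtain ⟨k, hk⟩ := this
      exact Finset.prod_eq_zero (Finset.mem_univ k) 
        (Set.indicator_of_notMem (show W n k ω ∉ inStratum S (σ k) from hk) _)
  rw [← integral_indicator (measurableSet_strataEvent hS h1.measurable n σ)]
  simp_rw [← hprod]
  rw [(h1.indep n).integral_fun_prod_comp (fun k => (h1.measurable n k).aemeasurable)
    fun k => (hFm k).aestronglyMeasurable]
  refine Finset.prod_eq_zero (Finset.mem_univ i) ?_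
  rw [← integral_map (h1.measurable n i).aemeasurable (hFm i).aestronglyMeasurable, h1.law,
    integral_indicator (measurableSet_inStratum hS _)]
  simp [hij, h0]

theorem integral_comp_eq (h1 : SamplingAssumption P W Q S) {n : ℕ} (i : Fin n)
    {h : Primitive Zc → ℝ} (hm : Measurable h) :
    ∫ ω, h (W n i ω) ∂(P n) = ∫ w, h w ∂Q := by
  rw [← h1.law n i, integral_map (h1.measurable n i).aemeasurable hm.aestronglyMeasurable]

variable {piA tau : St → ℝ} {pi0 : ℝ}

/-- Given the strata vector, the assignments are independent of the `W`s, so the expectation factors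
and the factor in the `W`s is zero. The dependence among the assignments plays no role. -/
theorem integral_assignment_mul_eq_zero (hS : Measurable S) (h1 : SamplingAssumption P W Q S)
    (h3 : AssignmentAssumption P W A Q S piA tau pi0) {n : ℕ} {h : Primitive Zc → ℝ}
    (hm : Measurable h) {K : ℝ} (hb : ∀ w, |h w| ≤ K)
    (h0 : ∀ t, ∫ w in inStratum S t, h w ∂Q = 0) {i j : Fin n} (hij : i ≠ j) (a : Bool) :
    ∫ ω, (if A n i ω = a then h (W n i ω) else 0) * (if A n j ω = a then h (W n j ω) else 0)
      ∂(P n) = 0 := by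
  let G : (Fin n → Bool) → ℝ := fun α => (if α i = a then 1 else 0) * (if α j = a then 1 else 0)
  let H : (Fin n → Primitive Zc) → ℝ := fun w => h (w i) * h (w j)
  have hG : Measurable G := measurable_of_finite G
  have hH : Measurable H :=
    (hm.comp (measurable_pi_apply i)).mul (hm.comp (measurable_pi_apply j))
  have hWm : Measurable fun ω i => W n i ω := measurable_pi_lambda _ (h1.measurable n)
  have hAm : Measurable fun ω i => A n i ω := measurable_pi_lambda _ (h3.measurable n)
  have hGH : ∀ ω, (if A n i ω = a then h (W n i ω) else 0)
      * (if A n j ω = a then h (W n j ω) else 0)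
      = H (fun i => W n i ω) * G (fun i => A n i ω) := by
    intro ω
    simp only [G, H]
    split_ifs <;> simp
  simp_rw [hGH]
  have hint : Integrable (fun ω => H (fun i => W n i ω) * G (fun i => A n i ω)) (P n) := by
    refine Integrable.of_bound (((hH.comp hWm).mul (hG.comp hAm)).aestronglyMeasurable) (K * K)
      (Eventually.of_forall fun ω => ?_)
    have h2 : |G fun i => A n i ω| ≤ 1 := by
      simp only [G]
      split_ifs <;> simp
    have hK : 0 ≤ K := (abs_nonneg _).trans (hb (W n i ω))
    rw [norm_mul, Real.norm_eq_abs, Real.norm_eq_abs, abs_mul]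
    calc _ ≤ (K * K) * 1 := by
            gcongr
            · exact hb _
            · exact hb _
      _ = K * K := mul_one _
  rw [integral_eq_sum_cond hS h1.measurable n hint]
  refine Finset.sum_eq_zero fun σ _ => ?_
  rw [(h3.cond_indep n σ).integral_fun_comp_mul_comp hWm.aemeasurable hAm.aemeasurable
    hH.aestronglyMeasurable hG.aestronglyMeasurable, ← mul_assoc, ← setIntegral_eq_real_mul_cond,
    setIntegral_strataEvent_mul_eq_zero hS h1 hm h0 hij, zero_mul]

/-- The average over the sample of `f(W_i) I{A_i = a}`. -/
def armAverage (W : ∀ n, Fin n → Ω n → Primitive Zc) (A : ∀ n, Fin n → Ω n → Bool) (a : Bool)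
    (f : Primitive Zc → ℝ) (n : ℕ) (ω : Ω n) : ℝ :=
  1 / (n : ℝ) * ∑ i, if A n i ω = a then f (W n i ω) else 0

theorem measurable_armTerm (h1 : SamplingAssumption P W Q S)
    (h3 : AssignmentAssumption P W A Q S piA tau pi0) {f : Primitive Zc → ℝ} (hf : Measurable f)
    (a : Bool) (n : ℕ) (i : Fin n) :
    Measurable fun ω => if A n i ω = a then f (W n i ω) else 0 :=
  Measurable.ite (h3.measurable n i (measurableSet_singleton a)) (hf.comp (h1.measurable n i))
    measurable_const

theorem integrable_comp (h1 : SamplingAssumption P W Q S) {f : Primitive Zc → ℝ}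
    (hfi : Integrable f Q) (n : ℕ) (i : Fin n) : Integrable (fun ω => f (W n i ω)) (P n) := by
  have := hfi
  rw [← h1.law n i] at this
  exact this.comp_measurable (h1.measurable n i)

theorem integrable_armTerm (h1 : SamplingAssumption P W Q S)
    (h3 : AssignmentAssumption P W A Q S piA tau pi0) {f : Primitive Zc → ℝ} (hf : Measurable f)
    (hfi : Integrable f Q) (a : Bool) (n : ℕ) (i : Fin n) :
    Integrable (fun ω => if A n i ω = a then f (W n i ω) else 0) (P n) := by
  refine (integrable_comp h1 hfi n i).mono
    (measurable_armTerm h1 h3 hf a n i).aestronglyMeasurable (Eventually.of_forall fun ω => ?_)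
  split_ifs <;> simp

theorem integrable_armAverage (h1 : SamplingAssumption P W Q S)
    (h3 : AssignmentAssumption P W A Q S piA tau pi0) {f : Primitive Zc → ℝ} (hf : Measurable f)
    (hfi : Integrable f Q) (a : Bool) (n : ℕ) : Integrable (armAverage W A a f n) (P n) :=
  (integrable_finsetSum _ fun i _ => integrable_armTerm h1 h3 hf hfi a n i).const_mul _

/-- A bound uniform in `n` that controls the truncation remainder, for which no second moment is
available. -/
theorem integral_abs_armAverage_le (h1 : SamplingAssumption P W Q S)
    (h3 : AssignmentAssumption P W A Q S piA tau pi0) {f : Primitive Zc → ℝ} (hf : Measurable f)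
    (hfi : Integrable f Q) (a : Bool) (n : ℕ) :
    ∫ ω, |armAverage W A a f n ω| ∂(P n) ≤ ∫ w, |f w| ∂Q := by
  have hpt : ∀ ω, |armAverage W A a f n ω| ≤ 1 / (n : ℝ) * ∑ i, |f (W n i ω)| := by
    intro ω
    rw [armAverage, abs_mul, abs_of_nonneg (by positivity : (0 : ℝ) ≤ 1 / n)]
    refine mul_le_mul_of_nonneg_left ?_ (by positivity)
    refine (Finset.abs_sum_le_sum_abs _ _).trans (Finset.sum_le_sum fun i _ => ?_)
    split_ifs <;> simp
  have hi : ∀ i, Integrable (fun ω => |f (W n i ω)|) (P n) := fun i =>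
    (integrable_comp h1 hfi n i).abs
  refine (integral_mono (integrable_armAverage h1 h3 hf hfi a n).abs
    ((integrable_finsetSum _ fun i _ => hi i).const_mul _) hpt).trans ?_
  rw [integral_const_mul, integral_finsetSum _ fun i _ => hi i]
  simp_rw [integral_comp_eq h1 _ hf.abs]
  have h0 : 0 ≤ ∫ w, |f w| ∂Q := integral_nonneg fun _ => abs_nonneg _
  rcases Nat.eq_zero_or_pos n with rfl | hn
  · simpa using h0
  · have : (n : ℝ) ≠ 0 := by positivity
    simp only [Finset.sum_const, Finset.card_univ, Fintype.card_fin, nsmul_eq_mul]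
    field_simp
    exact le_rfl

/-- Truncate `f`: the bounded part has orthogonal terms and `L¹` norm at most `C / √n`, while the
remainder is small in `L¹` uniformly in `n`. -/
theorem tendsto_integral_abs_armAverage_center (hS : Measurable S)
    (h1 : SamplingAssumption P W Q S) (h3 : AssignmentAssumption P W A Q S piA tau pi0)
    {f : Primitive Zc → ℝ} (hf : Measurable f) (hfi : Integrable f Q) (a : Bool) (s : St) :
    Tendsto (fun n => ∫ ω, |armAverage W A a (center Q S s f) n ω| ∂(P n)) atTop (𝓝 0) := by
  rw [Metric.tendsto_atTop]
  intro ε hε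
  have hs := h1.strata_pos s
  -- Centering doubles the remainder, so `ε / 4` leaves `ε / 2` for the bounded part.
  obtain ⟨K, hK⟩ := ((tendsto_integral_abs_sub_cutoff hf hfi).eventually
    (gt_mem_nhds (show (0 : ℝ) < ε / 4 by positivity))).exists
  have hgm := measurable_cutoff K hf
  have hgi : Integrable (cutoff K f) Q := integrable_cutoff K hf
  have hdm : Measurable fun w => f w - cutoff K f w := hf.sub hgm
  have hdi : Integrable (fun w => f w - cutoff K f w) Q := hfi.sub hgi
  obtain ⟨C, hC0, hC⟩ := exists_bound_center (Q := Q) (S := S) s (abs_cutoff_le K f)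
  have hlim : Tendsto (fun n : ℕ => C / Real.sqrt n) atTop (𝓝 0) :=
    tendsto_const_nhds.div_atTop (Real.tendsto_sqrt_atTop.comp tendsto_natCast_atTop_atTop)
  obtain ⟨N, hN⟩ := eventually_atTop.1
    (hlim.eventually (gt_mem_nhds (show (0 : ℝ) < ε / 2 by positivity)))
  refine ⟨N, fun n hn => ?_⟩
  have hsplit : ∀ ω, armAverage W A a (center Q S s f) n ω
      = armAverage W A a (center Q S s (cutoff K f)) n ω
        + armAverage W A a (center Q S s fun w => f w - cutoff K f w) n ω := by
    intro ω
    simp only [armAverage]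
    rw [← mul_add, ← Finset.sum_add_distrib]
    congr 1
    refine Finset.sum_congr rfl fun i _ => ?_
    split_ifs
    · rw [center_sub s hfi hgi]
      ring
    · simp
  have hA1 : ∫ ω, |armAverage W A a (center Q S s (cutoff K f)) n ω| ∂(P n)
      ≤ C / Real.sqrt n := by
    refine integral_abs_average_le hC0
      (measurable_armTerm h1 h3 (measurable_center hS s hgm) a n) (fun i ω => ?_)
      fun i j hij => integral_assignment_mul_eq_zero hS h1 h3 (measurable_center hS s hgm) hC
        (setIntegral_center hS hs hgi) hij a
    split_ifs
    · exact hC _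
    · simpa using hC0
  have hA2 : ∫ ω, |armAverage W A a (center Q S s fun w => f w - cutoff K f w) n ω| ∂(P n)
      ≤ 2 * ∫ w, |f w - cutoff K f w| ∂Q :=
    (integral_abs_armAverage_le h1 h3 (measurable_center hS s hdm)
      (integrable_center hS s hdi) a n).trans
      (integral_abs_center_le hS hs hdi)
  have hi1 := (integrable_armAverage h1 h3 (measurable_center (Q := Q) hS s hgm)
    (integrable_center hS s hgi) a n).abs
  have hi2 := (integrable_armAverage h1 h3 (measurable_center (Q := Q) hS s hdm)
    (integrable_center hS s hdi) a n).abs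
  have hle : ∫ ω, |armAverage W A a (center Q S s f) n ω| ∂(P n)
      ≤ C / Real.sqrt n + 2 * ∫ w, |f w - cutoff K f w| ∂Q := by
    refine le_trans ?_ (add_le_add hA1 hA2)
    rw [← integral_add hi1 hi2]
    refine integral_mono (integrable_armAverage h1 h3 (measurable_center hS s hf)
      (integrable_center hS s hfi) a n).abs (hi1.add hi2) fun ω => ?_
    dsimp only
    rw [hsplit]
    exact abs_add_le _ _
  rw [Real.dist_eq, sub_zero, abs_of_nonneg (integral_nonneg fun _ => abs_nonneg _)]
  have := hN n hn
  linarith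

theorem tendsto_armAverage_center (hS : Measurable S)
    (h1 : SamplingAssumption P W Q S) (h3 : AssignmentAssumption P W A Q S piA tau pi0)
    {f : Primitive Zc → ℝ} (hf : Measurable f) (hfi : Integrable f Q) (a : Bool) (s : St) :
    Tendsto (fun x : Σ n, Ω n => armAverage W A a (center Q S s f) x.1 x.2) (probFilter P)
      (𝓝 0) := by
  rw [← tendstoInProb_iff]
  refine tendstoInProb_of_integral_abs P (fun n => ?_) ?_
  · simpa using integrable_armAverage h1 h3 (measurable_center hS s hf)
      (integrable_center hS s hfi) a n
  · simpa using tendsto_integral_abs_armAverage_center hS h1 h3 hf hfi a s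

/-- The proportion of participants in stratum `s` converges to `p(s)`. -/
theorem tendsto_nS_div (hS : Measurable S) (h1 : SamplingAssumption P W Q S)
    (A : ∀ n, Fin n → Ω n → Bool) (s : St) :
    Tendsto (fun x : Σ n, Ω n => (data S W A x.1 x.2).nS s / x.1) (probFilter P)
      (𝓝 (p Q S s)) := by
  rw [← tendstoInProb_iff P (T := fun n ω => (data S W A n ω).nS s / n)]
  let h : Primitive Zc → ℝ := fun w => (inStratum S s).indicator (fun _ => (1 : ℝ)) w - p Q S s
  have hm : Measurable h :=
    (measurable_const.indicator (measurableSet_inStratum hS s)).sub_const _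
  have hb : ∀ w, |h w| ≤ 1 + |p Q S s| := by
    intro w
    refine (abs_sub _ _).trans (add_le_add ?_ le_rfl)
    by_cases hw : w ∈ inStratum S s <;> simp [hw]
  have hint : Integrable h Q :=
    Integrable.of_bound hm.aestronglyMeasurable _ (Eventually.of_forall hb)
  have h0 : ∫ w, h w ∂Q = 0 := by
    have hi : Integrable ((inStratum S s).indicator (fun _ => (1 : ℝ))) Q :=
      (integrable_const _).indicator (measurableSet_inStratum hS s)
    rw [integral_sub hi (integrable_const _), integral_indicator (measurableSet_inStratum hS s)]
    simp [p]
  have heq : ∀ n (_ : n ≠ 0) ω, (data S W A n ω).nS s / n - p Q S s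
      = 1 / (n : ℝ) * ∑ i, h (W n i ω) := by
    intro n hn ω
    have hn' : (n : ℝ) ≠ 0 := Nat.cast_ne_zero.2 hn
    simp only [h, Finset.sum_sub_distrib, Finset.sum_const, Finset.card_univ, Fintype.card_fin,
      nsmul_eq_mul, mul_sub, one_div, inv_mul_cancel_left₀ hn']
    rw [div_eq_inv_mul]
    congr 2
    refine Finset.sum_congr rfl fun i _ => ?_
    by_cases hi : stratum S (W n i ω) = s <;>
      simp [inStratum, data, observe, hi]
  refine tendstoInProb_of_integral_abs P (fun n => ?_) ?_
  -- For the empty sample the quotient is `0`, and the representation `heq` as an average of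
  -- centered terms is not available.
  · rcases eq_or_ne n 0 with rfl | hn
    · have : (fun ω => (data S W A 0 ω).nS s / ((0 : ℕ) : ℝ) - p Q S s)
          = fun _ => 0 - p Q S s := by
        simp
      rw [this]
      exact integrable_const _
    · simp_rw [heq n hn]
      exact (integrable_finsetSum _ fun i _ => integrable_comp h1 hint n i).const_mul _
  · have hlim : Tendsto (fun n : ℕ => (1 + |p Q S s|) / Real.sqrt n) atTop (𝓝 0) :=
      tendsto_const_nhds.div_atTop (Real.tendsto_sqrt_atTop.comp tendsto_natCast_atTop_atTop)
    refine squeeze_zero' (Eventually.of_forall fun n => integral_nonneg fun _ => abs_nonneg _)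
      ?_ hlim
    filter_upwards [eventually_ne_atTop 0] with n hn
    simp_rw [heq n hn]
    refine integral_abs_average_le (by positivity) (fun i => hm.comp (h1.measurable n i))
      (fun i ω => hb _) fun i j hij => ?_
    rw [((h1.indep n).indepFun hij).integral_fun_comp_mul_comp (h1.measurable n i).aemeasurable
      (h1.measurable n j).aemeasurable hm.aestronglyMeasurable hm.aestronglyMeasurable,
      integral_comp_eq h1 i hm, h0, zero_mul]

end LLN

end CARLate

namespace CARLate

/-! ### Treated proportions and the law of large numbers within arms -/

section Assignment

variable {Zc St : Type*} [MeasurableSpace Zc] [Fintype St] [DecidableEq St]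
  [MeasurableSpace St] [MeasurableSingletonClass St]
  {Q : Measure (Primitive Zc)} [IsProbabilityMeasure Q] {S : Zc → St}
  {Ω : ℕ → Type*} [∀ n, MeasurableSpace (Ω n)] {P : ∀ n, Measure (Ω n)}
  [∀ n, IsProbabilityMeasure (P n)] {W : ∀ n, Fin n → Ω n → Primitive Zc}
  {A : ∀ n, Fin n → Ω n → Bool} {piA tau : St → ℝ} {pi0 : ℝ}

/-- A continuous function between the indicators of `|x_s| ≥ M + 1` and of `|x_s| ≥ M`. -/
def tailBump (s : St) (M : ℝ) : EuclideanSpace ℝ St →ᵇ ℝ :=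
  BoundedContinuousFunction.ofNormedAddCommGroup (fun x => min 1 (max 0 (|x s| - M)))
    (by fun_prop) 1 (fun x => by
      rw [Real.norm_eq_abs, abs_of_nonneg (le_min zero_le_one (le_max_left _ _))]
      exact min_le_left _ _)

theorem tailBump_apply (s : St) (M : ℝ) (x : EuclideanSpace ℝ St) :
    tailBump s M x = min 1 (max 0 (|x s| - M)) := rfl

theorem tailBump_nonneg (s : St) (M : ℝ) (x : EuclideanSpace ℝ St) : 0 ≤ tailBump s M x :=
  le_min zero_le_one (le_max_left _ _)

theorem tailBump_le_one (s : St) (M : ℝ) (x : EuclideanSpace ℝ St) : tailBump s M x ≤ 1 :=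
  min_le_left _ _

theorem tailBump_eq_one {s : St} {M : ℝ} {x : EuclideanSpace ℝ St} (h : M + 1 ≤ |x s|) :
    tailBump s M x = 1 :=
  min_eq_left ((by linarith : (1 : ℝ) ≤ |x s| - M).trans (le_max_right _ _))

/-- Tightness of a single probability measure, by dominated convergence; nothing Gaussian is
involved. -/
theorem tendsto_integral_tailBump (s : St) (ν : Measure (EuclideanSpace ℝ St))
    [IsProbabilityMeasure ν] :
    Tendsto (fun M : ℕ => ∫ x, tailBump s M x ∂ν) atTop (𝓝 0) := by
  rw [← integral_zero (EuclideanSpace ℝ St) ℝ (μ := ν)]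
  refine tendsto_integral_of_dominated_convergence (fun _ => 1)
    (fun M => (tailBump s M).continuous.aestronglyMeasurable) (integrable_const _)
    (fun M => Eventually.of_forall fun x => ?_) (Eventually.of_forall fun x => ?_)
  · rw [Real.norm_eq_abs, abs_of_nonneg (tailBump_nonneg _ _ _)]
    exact tailBump_le_one _ _ _
  · refine tendsto_const_nhds.congr' ?_
    filter_upwards [eventually_ge_atTop ⌈|x s|⌉₊] with M hM
    have : |x s| ≤ M := Nat.ceil_le.1 hM
    rw [tailBump_apply, max_eq_left (by linarith), min_eq_right zero_le_one]

theorem measurable_strataVec (hS : Measurable S) (hW : ∀ n i, Measurable (W n i)) (n : ℕ) :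
    Measurable (strataVec S W n) :=
  measurable_pi_lambda _ fun i => (measurable_stratum hS).comp (hW n i)

/-- The imbalance depends only on the strata and the assignments, which take finitely many values;
hence any `f` will do. -/
theorem measurable_comp_imbalance (hS : Measurable S) (hW : ∀ n i, Measurable (W n i))
    (hA : ∀ n i, Measurable (A n i)) (f : EuclideanSpace ℝ St → ℝ) (n : ℕ) :
    Measurable fun ω => f (imbalance S W A piA n ω) := by
  let φ : (Fin n → St) × (Fin n → Bool) → ℝ := fun q => f (WithLp.toLp 2 fun s =>
    Real.sqrt n * ((∑ i, if q.2 i = true ∧ q.1 i = s then 1 else 0)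
      / (∑ i, if q.1 i = s then 1 else 0) - piA s))
  have hφ : Measurable φ := measurable_of_finite φ
  have hq : Measurable fun ω => (strataVec S W n ω, fun i => A n i ω) :=
    (measurable_strataVec hS hW n).prodMk (measurable_pi_lambda _ (hA n))
  have heq : ∀ ω, f (imbalance S W A piA n ω) = φ (strataVec S W n ω, fun i => A n i ω) := by
    intro ω
    simp only [φ, imbalance, Obs.nA, Obs.nS, data, observe, strataVec]
    congr!
  simp_rw [heq]
  exact hφ.comp hq

/-- The tower property, which turns the conditional convergence of the imbalance into an
unconditional bound. -/
theorem integral_integral_cond (hS : Measurable S) (hW : ∀ n i, Measurable (W n i)) (n : ℕ)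
    {f : Ω n → ℝ} (hf : Integrable f (P n)) :
    ∫ ω, ∫ ω', f ω' ∂(ProbabilityTheory.cond (P n) (strataEvent S W n (strataVec S W n ω)))
      ∂(P n) = ∫ ω, f ω ∂(P n) := by
  let g : (Fin n → St) → ℝ := fun σ =>
    ∫ ω', f ω' ∂(ProbabilityTheory.cond (P n) (strataEvent S W n σ))
  have hg : Integrable (fun σ => g σ) ((P n).map (strataVec S W n)) := by
    have : IsProbabilityMeasure ((P n).map (strataVec S W n)) :=
      Measure.isProbabilityMeasure_map (measurable_strataVec hS hW n).aemeasurable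
    exact Integrable.of_finite
  rw [integral_eq_sum_cond hS hW n hf]
  change ∫ ω, g (strataVec S W n ω) ∂(P n) = ∑ σ, (P n).real (strataEvent S W n σ) * g σ
  rw [← integral_map (f := g) (measurable_strataVec hS hW n).aemeasurable
    hg.aestronglyMeasurable, integral_fintype hg]
  refine Finset.sum_congr rfl fun σ _ => ?_
  rw [map_measureReal_apply (measurable_strataVec hS hW n) (measurableSet_singleton σ)]
  rfl

/-- The treated proportion within a stratum converges to its target. -/
theorem tendsto_nA_div_nS (hS : Measurable S) (h1 : SamplingAssumption P W Q S)
    (h3 : AssignmentAssumption P W A Q S piA tau pi0) (s : St) :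
    Tendsto (fun x : Σ n, Ω n => (data S W A x.1 x.2).nA s / (data S W A x.1 x.2).nS s)
      (probFilter P) (𝓝 pi0) := by
  rw [← tendstoInProb_iff P (T := fun n ω => (data S W A n ω).nA s / (data S W A n ω).nS s)]
  intro ε hε
  rw [Metric.tendsto_atTop]
  intro η hη
  -- The target `η` is spent in thirds: the limiting tail, the conditional approximation error, and
  -- the probability that this approximation fails.
  obtain ⟨M, hM⟩ := ((tendsto_integral_tailBump s
    (multivariateGaussian 0 (SigmaA Q S piA tau))).eventually
    (gt_mem_nhds (show (0 : ℝ) < η / 3 by positivity))).exists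
  have hcw := (h3.cond_normal (tailBump s M) (η / 3) (by positivity)).eventually
    (lt_mem_nhds (show 1 - η / 3 < 1 by linarith))
  -- From here on, a deviation of the proportion by `ε` forces the scaled imbalance beyond `M + 1`,
  -- where the bump equals one.
  have hsq : ∀ᶠ n : ℕ in atTop, (M + 1) / ε ≤ Real.sqrt n :=
    (Real.tendsto_sqrt_atTop.comp tendsto_natCast_atTop_atTop).eventually_ge_atTop _
  obtain ⟨N, hN⟩ := eventually_atTop.1 (hcw.and hsq)
  refine ⟨N, fun n hn => ?_⟩
  obtain ⟨hgood, hn2⟩ := hN n hn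
  rw [Real.dist_eq, sub_zero, abs_of_nonneg measureReal_nonneg]
  have hfm := measurable_comp_imbalance (piA := piA) hS h1.measurable h3.measurable
    (tailBump s M) n
  have hfi : Integrable (fun ω => tailBump s M (imbalance S W A piA n ω)) (P n) := by
    refine Integrable.of_bound hfm.aestronglyMeasurable 1 (Eventually.of_forall fun ω => ?_)
    rw [Real.norm_eq_abs, abs_of_nonneg (tailBump_nonneg _ _ _)]
    exact tailBump_le_one _ _ _
  have hle1 : (P n).real {ω | ε ≤ |(data S W A n ω).nA s / (data S W A n ω).nS s - pi0|}
      ≤ ∫ ω, tailBump s M (imbalance S W A piA n ω) ∂(P n) := by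
    have h := mul_meas_ge_le_integral_of_nonneg
      (Eventually.of_forall fun ω => tailBump_nonneg s M (imbalance S W A piA n ω)) hfi 1
    rw [one_mul] at h
    refine (measureReal_mono fun ω hω => ?_).trans h
    refine ge_of_eq (tailBump_eq_one ?_)
    change (M : ℝ) + 1 ≤ |Real.sqrt n * ((data S W A n ω).nA s / (data S W A n ω).nS s - piA s)|
    rw [h3.const_target, abs_mul, abs_of_nonneg (Real.sqrt_nonneg _)]
    rw [div_le_iff₀ hε] at hn2
    exact hn2.trans (mul_le_mul_of_nonneg_left hω (Real.sqrt_nonneg _))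
  let g : (Fin n → St) → ℝ := fun σ => ∫ ω', tailBump s M (imbalance S W A piA n ω')
    ∂(ProbabilityTheory.cond (P n) (strataEvent S W n σ))
  let c : ℝ := ∫ x, tailBump s M x ∂(multivariateGaussian 0 (SigmaA Q S piA tau))
  let G : Set (Ω n) := {ω | |g (strataVec S W n ω) - c| ≤ η / 3}
  have hGm : MeasurableSet G := by
    have : MeasurableSet {σ : Fin n → St | |g σ - c| ≤ η / 3} := Set.Finite.measurableSet
      (Set.toFinite _)
    exact measurable_strataVec hS h1.measurable n this
  -- On a null strata event the conditional measure is zero, and so is `g`.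
  have hg1 : ∀ σ, g σ ≤ 1 := by
    intro σ
    by_cases h0 : P n (strataEvent S W n σ) = 0
    · simp [g, ProbabilityTheory.cond_eq_zero_of_meas_eq_zero h0]
    · have := ProbabilityTheory.cond_isProbabilityMeasure h0
      have hb : g σ ≤ ∫ _, (1 : ℝ) ∂(ProbabilityTheory.cond (P n) (strataEvent S W n σ)) := by
        refine integral_mono_of_nonneg (Eventually.of_forall fun ω => tailBump_nonneg _ _ _)
          (integrable_const _) (Eventually.of_forall fun ω => tailBump_le_one _ _ _)
      simpa using hb
  have hgi : Integrable (fun ω => g (strataVec S W n ω)) (P n) :=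
    ((measurable_of_finite g).comp (measurable_strataVec hS h1.measurable n)).aestronglyMeasurable
      |> fun h => (Integrable.of_bound h (∑ σ, |g σ|) (Eventually.of_forall fun ω =>
        Finset.single_le_sum (f := fun σ => |g σ|) (fun _ _ => abs_nonneg _) (Finset.mem_univ _)))
  -- On `G` the conditional expectation is at most `c + η / 3`; off `G` it is at most one.
  have hle2 : ∫ ω, g (strataVec S W n ω) ∂(P n) ≤ (c + η / 3) + (P n).real Gᶜ := by
    have hint : Integrable (fun ω => (c + η / 3) + Gᶜ.indicator (fun _ => (1 : ℝ)) ω) (P n) :=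
      (integrable_const _).add ((integrable_const _).indicator hGm.compl)
    refine (integral_mono hgi hint fun ω => ?_).trans (le_of_eq ?_)
    · have hc0 : 0 ≤ c := integral_nonneg fun _ => tailBump_nonneg _ _ _
      by_cases hω : ω ∈ G
      · have := (abs_le.1 (show |g (strataVec S W n ω) - c| ≤ η / 3 from hω)).2
        simp only [Set.indicator_of_notMem (Set.notMem_compl_iff.2 hω), add_zero]
        linarith
      · have := hg1 (strataVec S W n ω)
        simp only [Set.indicator_of_mem (Set.mem_compl hω)]
        linarith
    · rw [integral_add (integrable_const _) ((integrable_const _).indicator hGm.compl),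
        integral_indicator hGm.compl]
      simp
  rw [probReal_compl_eq_one_sub hGm] at hle2
  have htower := integral_integral_cond hS h1.measurable n hfi
  change ∫ ω, g (strataVec S W n ω) ∂(P n) = _ at htower
  have hgood' : 1 - η / 3 < (P n).real G := hgood
  have hM' : c < η / 3 := hM
  rw [← htower] at hle1
  linarith

/-- `π_A` or `1 - π_A`, according to the assignment. -/
def armProb (pi0 : ℝ) (a : Bool) : ℝ := if a = true then pi0 else 1 - pi0

/-- The treated share is `n_A(s)/n = (n_A(s)/n(s)) (n(s)/n)`; the control share is its complement
within the stratum. -/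
theorem tendsto_armAverage_one (hS : Measurable S) (h1 : SamplingAssumption P W Q S)
    (h3 : AssignmentAssumption P W A Q S piA tau pi0) (a : Bool) (s : St) :
    Tendsto (fun x : Σ n, Ω n =>
        armAverage W A a ((inStratum S s).indicator fun _ => 1) x.1 x.2)
      (probFilter P) (𝓝 (armProb pi0 a * p Q S s)) := by
  have hn := tendsto_nS_div (Q := Q) hS h1 A s
  have hr := tendsto_nA_div_nS hS h1 h3 s
  have hA : Tendsto (fun x : Σ n, Ω n => (data S W A x.1 x.2).nA s / x.1) (probFilter P)
      (𝓝 (pi0 * p Q S s)) := by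
    refine (hr.mul hn).congr' ?_
    filter_upwards [hn.eventually_ne (h1.strata_pos s).ne'] with x hx
    have h0 : (data S W A x.1 x.2).nS s ≠ 0 := fun h => hx (by rw [h, zero_div])
    rw [div_mul_div_cancel₀ h0]
  have htrue : ∀ x : Σ n, Ω n, (data S W A x.1 x.2).nA s / x.1
      = armAverage W A true ((inStratum S s).indicator fun _ => 1) x.1 x.2 := by
    intro x
    rw [armAverage, one_div, div_eq_inv_mul]
    congr 1
    refine Finset.sum_congr rfl fun i _ => ?_
    by_cases hi : stratum S (W x.1 i x.2) = s <;> by_cases ha : A x.1 i x.2 = true <;>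
      simp [inStratum, data, observe, hi, ha]
  have hfalse : ∀ x : Σ n, Ω n, (data S W A x.1 x.2).nS s / x.1
        - (data S W A x.1 x.2).nA s / x.1
      = armAverage W A false ((inStratum S s).indicator fun _ => 1) x.1 x.2 := by
    intro x
    rw [armAverage, one_div, div_eq_inv_mul, div_eq_inv_mul, ← mul_sub]
    congr 1
    rw [Obs.nS, Obs.nA, ← Finset.sum_sub_distrib]
    refine Finset.sum_congr rfl fun i _ => ?_
    by_cases hi : stratum S (W x.1 i x.2) = s <;> by_cases ha : A x.1 i x.2 = true <;>
      simp [inStratum, data, observe, hi, ha]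
  cases a
  · refine Tendsto.congr hfalse ?_
    have := hn.sub hA
    rwa [show p Q S s - pi0 * p Q S s = armProb pi0 false * p Q S s by
      simp [armProb]; ring] at this
  · exact Tendsto.congr htrue (by simpa [armProb] using hA)

/-- The law of large numbers within the arms of a stratum. -/
theorem tendsto_armAverage (hS : Measurable S) (h1 : SamplingAssumption P W Q S)
    (h3 : AssignmentAssumption P W A Q S piA tau pi0) {f : Primitive Zc → ℝ}
    (hf : Measurable f) (hfi : Integrable f Q) (a : Bool) (s : St) :
    Tendsto (fun x : Σ n, Ω n => armAverage W A a ((inStratum S s).indicator f) x.1 x.2)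
      (probFilter P) (𝓝 (armProb pi0 a * ∫ w in inStratum S s, f w ∂Q)) := by
  have hs := (h1.strata_pos s).ne'
  -- Inside the stratum, `f` is its centered version plus its stratum mean times the constant one.
  have h := (tendsto_armAverage_center hS h1 h3 hf hfi a s).add
    ((tendsto_armAverage_one hS h1 h3 a s).const_mul
      ((∫ w in inStratum S s, f w ∂Q) / p Q S s))
  rw [show 0 + (∫ w in inStratum S s, f w ∂Q) / p Q S s * (armProb pi0 a * p Q S s)
    = armProb pi0 a * ∫ w in inStratum S s, f w ∂Q by field_simp; simp] at h
  refine h.congr fun x => ?_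
  simp only [armAverage]
  rw [mul_left_comm, ← mul_add, Finset.mul_sum, ← Finset.sum_add_distrib]
  congr 1
  refine Finset.sum_congr rfl fun i _ => ?_
  by_cases hi : W x.1 i x.2 ∈ inStratum S s <;> by_cases ha : A x.1 i x.2 = a <;>
    simp [center, hi, ha]

end Assignment

end CARLate

namespace CARLate

namespace Obs

/-! ### The saturated regression in terms of cell moments -/

section Cells

variable {n : ℕ} {St : Type*} [DecidableEq St] (X : Obs n St)

/-- `(1/n) ∑ᵢ I{D_i = d, A_i = a, S_i = s} Y_i ^ k`. -/
def moment (k : ℕ) (d a : Bool) (s : St) : ℝ :=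
  1 / n * ∑ i, if X.D i = d ∧ X.A i = a ∧ X.S i = s then X.Y i ^ k else 0

/-- `∑ᵢ I{S_i = s} Y_i`. -/
def sumY (s : St) : ℝ := ∑ i, X.ind i s * X.Y i

/-- `∑ᵢ A_i I{S_i = s} Y_i`. -/
def sumAY (s : St) : ℝ := ∑ i, num (X.A i) * X.ind i s * X.Y i

theorem nAD_div (s : St) : X.nAD s / n = X.moment 0 true true s := by
  simp only [nAD, moment]
  rw [div_eq_inv_mul, one_div]
  congr 1
  refine Finset.sum_congr rfl fun i _ => ?_
  cases X.D i <;> cases X.A i <;> by_cases hs : X.S i = s <;> simp [hs]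

theorem nA_div (s : St) : X.nA s / n = X.moment 0 true true s + X.moment 0 false true s := by
  simp only [nA, moment]
  rw [div_eq_inv_mul, one_div, ← mul_add, ← Finset.sum_add_distrib]
  congr 1
  refine Finset.sum_congr rfl fun i _ => ?_
  cases X.D i <;> cases X.A i <;> by_cases hs : X.S i = s <;> simp [hs]

theorem nD_div (s : St) : X.nD s / n = X.moment 0 true true s + X.moment 0 true false s := by
  simp only [nD, moment]
  rw [div_eq_inv_mul, one_div, ← mul_add, ← Finset.sum_add_distrib]
  congr 1
  refine Finset.sum_congr rfl fun i _ => ?_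
  cases X.D i <;> cases X.A i <;> by_cases hs : X.S i = s <;> simp [hs]

theorem nS_div (s : St) : X.nS s / n = X.moment 0 true true s + X.moment 0 false true s
    + X.moment 0 true false s + X.moment 0 false false s := by
  simp only [nS, moment]
  rw [div_eq_inv_mul, one_div, ← mul_add, ← mul_add, ← mul_add, ← Finset.sum_add_distrib,
    ← Finset.sum_add_distrib, ← Finset.sum_add_distrib]
  congr 1
  refine Finset.sum_congr rfl fun i _ => ?_
  cases X.D i <;> cases X.A i <;> by_cases hs : X.S i = s <;> simp [hs]

theorem sumY_div (s : St) : X.sumY s / n = X.moment 1 true true s + X.moment 1 false true s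
    + X.moment 1 true false s + X.moment 1 false false s := by
  simp only [sumY, moment]
  rw [div_eq_inv_mul, one_div, ← mul_add, ← mul_add, ← mul_add, ← Finset.sum_add_distrib,
    ← Finset.sum_add_distrib, ← Finset.sum_add_distrib]
  congr 1
  refine Finset.sum_congr rfl fun i _ => ?_
  cases X.D i <;> cases X.A i <;> by_cases hs : X.S i = s <;> simp [hs, ind]

theorem sumAY_div (s : St) :
    X.sumAY s / n = X.moment 1 true true s + X.moment 1 false true s := by
  simp only [sumAY, moment]
  rw [div_eq_inv_mul, one_div, ← mul_add, ← Finset.sum_add_distrib]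
  congr 1
  refine Finset.sum_congr rfl fun i _ => ?_
  cases X.D i <;> cases X.A i <;> by_cases hs : X.S i = s <;> simp [hs, ind, num]

variable [Fintype St]

theorem Xsat_mulVec (v : St ⊕ St → ℝ) (i : Fin n) :
    (X.Xsat *ᵥ v) i = v (Sum.inl (X.S i)) + num (X.D i) * v (Sum.inr (X.S i)) := by
  simp [Matrix.mulVec, dotProduct, Xsat, ind]

theorem Zsat_transpose_mulVec_inl (y : Fin n → ℝ) (s : St) :
    (X.Zsatᵀ *ᵥ y) (Sum.inl s) = ∑ i, X.ind i s * y i := by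
  simp [Matrix.mulVec, dotProduct, Zsat]

theorem Zsat_transpose_mulVec_inr (y : Fin n → ℝ) (s : St) :
    (X.Zsatᵀ *ᵥ y) (Sum.inr s) = ∑ i, num (X.A i) * X.ind i s * y i := by
  simp [Matrix.mulVec, dotProduct, Zsat]

/-- With the next lemma: `Z'X` couples only the two coefficients of the same stratum, through the
block with rows `(n(s), n_D(s))` and `(n_A(s), n_AD(s))`. -/
theorem gram_mulVec_inl (v : St ⊕ St → ℝ) (s : St) :
    ((X.Zsatᵀ * X.Xsat) *ᵥ v) (Sum.inl s)
      = X.nS s * v (Sum.inl s) + X.nD s * v (Sum.inr s) := by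
  rw [← Matrix.mulVec_mulVec, Zsat_transpose_mulVec_inl, nS, nD, Finset.sum_mul, Finset.sum_mul,
    ← Finset.sum_add_distrib]
  refine Finset.sum_congr rfl fun i _ => ?_
  rw [Xsat_mulVec]
  by_cases hs : X.S i = s <;> cases X.D i <;> simp [hs, ind, num]

theorem gram_mulVec_inr (v : St ⊕ St → ℝ) (s : St) :
    ((X.Zsatᵀ * X.Xsat) *ᵥ v) (Sum.inr s)
      = X.nA s * v (Sum.inl s) + X.nAD s * v (Sum.inr s) := by
  rw [← Matrix.mulVec_mulVec, Zsat_transpose_mulVec_inr, nA, nAD, Finset.sum_mul,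
    Finset.sum_mul, ← Finset.sum_add_distrib]
  refine Finset.sum_congr rfl fun i _ => ?_
  rw [Xsat_mulVec]
  by_cases hs : X.S i = s <;> cases X.D i <;> cases X.A i <;> simp [hs, ind, num]

/-- The determinant of the block of `Z'X` that belongs to stratum `s`. -/
def blockDet (s : St) : ℝ := X.nS s * X.nAD s - X.nD s * X.nA s

/-- Elimination within each block shows that the kernel is trivial, so no reordering into
block-diagonal form is needed. -/
theorem isUnit_det_gram (h : ∀ s, X.blockDet s ≠ 0) : IsUnit (X.Zsatᵀ * X.Xsat).det := by
  rw [← Matrix.isUnit_iff_isUnit_det, ← Matrix.mulVec_injective_iff_isUnit]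
  refine (injective_iff_map_eq_zero' (Matrix.mulVecLin (X.Zsatᵀ * X.Xsat))).2 fun v =>
    ⟨fun hv => ?_, fun hv => by rw [hv, map_zero]⟩
  rw [Matrix.mulVecLin_apply] at hv
  have h1 : ∀ s, X.nS s * v (Sum.inl s) + X.nD s * v (Sum.inr s) = 0 := fun s => by
    rw [← gram_mulVec_inl, hv]
    rfl
  have h2 : ∀ s, X.nA s * v (Sum.inl s) + X.nAD s * v (Sum.inr s) = 0 := fun s => by
    rw [← gram_mulVec_inr, hv]
    rfl
  ext t
  rcases t with s | s
  · have : X.blockDet s * v (Sum.inl s) = 0 := by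
      rw [blockDet]
      linear_combination X.nAD s * h1 s - X.nD s * h2 s
    exact (mul_eq_zero.1 this).resolve_left (h s)
  · have : X.blockDet s * v (Sum.inr s) = 0 := by
      rw [blockDet]
      linear_combination X.nS s * h2 s - X.nA s * h1 s
    exact (mul_eq_zero.1 this).resolve_left (h s)

/-- Cramer's rule in each block, verified by multiplying back. -/
theorem coefSat_eq (h : ∀ s, X.blockDet s ≠ 0) :
    X.coefSat = Sum.elim
      (fun s => (X.sumY s * X.nAD s - X.nD s * X.sumAY s) / X.blockDet s)
      (fun s => (X.nS s * X.sumAY s - X.nA s * X.sumY s) / X.blockDet s) := by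
  set v : St ⊕ St → ℝ := Sum.elim
      (fun s => (X.sumY s * X.nAD s - X.nD s * X.sumAY s) / X.blockDet s)
      (fun s => (X.nS s * X.sumAY s - X.nA s * X.sumY s) / X.blockDet s) with hv
  have key : (X.Zsatᵀ * X.Xsat) *ᵥ v = X.Zsatᵀ *ᵥ X.Y := by
    ext t
    rcases t with s | s
    · rw [gram_mulVec_inl, Zsat_transpose_mulVec_inl]
      change _ = X.sumY s
      have := h s
      simp only [hv, Sum.elim_inl, Sum.elim_inr]
      field_simp
      rw [blockDet]
      ring
    · rw [gram_mulVec_inr, Zsat_transpose_mulVec_inr]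
      change _ = X.sumAY s
      have := h s
      simp only [hv, Sum.elim_inl, Sum.elim_inr]
      field_simp
      rw [blockDet]
      ring
  rw [coefSat, ← key, Matrix.mulVec_mulVec, Matrix.nonsing_inv_mul _ (X.isUnit_det_gram h),
    Matrix.one_mulVec]

theorem resid_eq (i : Fin n) :
    X.resid i = X.Y i - X.gammaSatHat (X.S i) - num (X.D i) * X.betaSatIn (X.S i) := by
  simp [resid, ind]

/-- Within a cell the residual is `Y_i` shifted by a constant, so the square expands into the three
cell moments. -/
theorem cellSq_eq (d a : Bool) (s : St) (c : ℝ) :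
    X.cellSq d a s c = X.moment 2 d a s
      + 2 * (c - X.gammaSatHat s - num d * X.betaSatIn s) * X.moment 1 d a s
      + (c - X.gammaSatHat s - num d * X.betaSatIn s) ^ 2 * X.moment 0 d a s := by
  simp only [cellSq, moment]
  have h : ∑ i, (if X.D i = d ∧ X.A i = a ∧ X.S i = s then (X.resid i + c) ^ 2 else 0)
      = (∑ i, if X.D i = d ∧ X.A i = a ∧ X.S i = s then X.Y i ^ 2 else 0)
        + 2 * (c - X.gammaSatHat s - num d * X.betaSatIn s)
          * (∑ i, if X.D i = d ∧ X.A i = a ∧ X.S i = s then X.Y i ^ 1 else 0)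
        + (c - X.gammaSatHat s - num d * X.betaSatIn s) ^ 2
          * (∑ i, if X.D i = d ∧ X.A i = a ∧ X.S i = s then X.Y i ^ 0 else 0) := by
    rw [Finset.mul_sum, Finset.mul_sum, ← Finset.sum_add_distrib, ← Finset.sum_add_distrib]
    refine Finset.sum_congr rfl fun i _ => ?_
    by_cases hi : X.D i = d ∧ X.A i = a ∧ X.S i = s
    · simp only [if_pos hi]
      rw [resid_eq, hi.1, hi.2.2]
      ring
    · simp only [if_neg hi]
      ring
  rw [h]
  ring

end Cells

/-! ### Limits of the estimators -/

section Limits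

variable {St : Type*} [Fintype St] [DecidableEq St]

/-- The limits of the cell moments: `m k d a s` is the limit of the `k`-th moment in the cell,
relative to `π_A(a) p(s)`. -/
structure LimitCells (St : Type*) where
  pi0 : ℝ
  p : St → ℝ
  m : ℕ → Bool → Bool → St → ℝ

namespace LimitCells

variable (θ : LimitCells St)

def piD (a : Bool) (s : St) : ℝ := θ.m 0 true a s

def mean (a : Bool) (s : St) : ℝ := θ.m 1 true a s + θ.m 1 false a s

/-- The Wald ratio of the stratum. -/
def beta (s : St) : ℝ := (θ.mean true s - θ.mean false s) / (θ.piD true s - θ.piD false s)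

/-- By the choice of `beta`, arm `false` yields the same intercept when the two treatment rates
differ. -/
def gamma (s : St) : ℝ := θ.mean true s - θ.piD true s * θ.beta s

def probC : ℝ := ∑ s, θ.p s * (θ.piD true s - θ.piD false s)

def betaAll : ℝ := ∑ s, θ.p s * (θ.piD true s - θ.piD false s) / θ.probC * θ.beta s

def cellSq (d a : Bool) (s : St) (c : ℝ) : ℝ :=
  θ.m 2 d a s + 2 * (c - θ.gamma s - num d * θ.beta s) * θ.m 1 d a s
    + (c - θ.gamma s - num d * θ.beta s) ^ 2 * θ.m 0 d a s

/-- The two shifts amount to adding `(D - π) (β(s) - β)` to the residual, so for regular limits this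
is the variance of `Y - β D` in the arm. -/
def armVar (a : Bool) (s : St) : ℝ :=
  θ.cellSq true a s ((1 - θ.piD a s) * (θ.beta s - θ.betaAll))
    + θ.cellSq false a s (-(θ.piD a s * (θ.beta s - θ.betaAll)))

/-- The formula of the estimator with every statistic replaced by its limit; the unsimplified
weights match `Obs.VsfeHat` factor by factor. -/
def Vsfe (tau : St → ℝ) : ℝ :=
  1 / θ.probC ^ 2 * ∑ s, (1 / θ.pi0) ^ 2 * (θ.pi0 * θ.p s * θ.armVar true s)
    + 1 / θ.probC ^ 2 * ∑ s, (1 / (1 - θ.pi0)) ^ 2 * ((1 - θ.pi0) * θ.p s * θ.armVar false s)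
    + 1 / θ.probC ^ 2 * ∑ s, θ.p s * (θ.piD true s - θ.piD false s) ^ 2
      * (θ.beta s - θ.betaAll) ^ 2
    + 1 / θ.probC ^ 2 * ∑ s, θ.p s * tau s * ((1 - 2 * θ.pi0) ^ 2 / (θ.pi0 * (1 - θ.pi0)))
      * (θ.piD true s - θ.piD false s) ^ 2 * (θ.beta s - θ.betaAll) ^ 2

/-- The nondegeneracy of the limits. -/
structure Regular : Prop where
  pi0_mem : θ.pi0 ∈ Set.Ioo (0 : ℝ) 1
  p_pos : ∀ s, 0 < θ.p s
  m_zero : ∀ a s, θ.m 0 true a s + θ.m 0 false a s = 1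
  piD_lt : ∀ s, 0 < θ.piD true s - θ.piD false s
  probC_ne : θ.probC ≠ 0

end LimitCells

/-! ### Convergence of the statistics along an arbitrary filter -/

variable {ι : Type*} {L : Filter ι} {N : ι → ℕ} {X : ∀ x, Obs (N x) St} {θ : LimitCells St}

/-- The cell moments of the samples `X x` converge to `θ`. -/
def MomentsTendsto (L : Filter ι) (X : ∀ x, Obs (N x) St) (θ : LimitCells St) : Prop :=
  ∀ k ≤ 2, ∀ d a s, Tendsto (fun x => (X x).moment k d a s) L
    (𝓝 (armProb θ.pi0 a * (θ.p s * θ.m k d a s)))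

theorem tendsto_nS_div' (hθ : θ.Regular) (hX : MomentsTendsto L X θ)
    (s : St) : Tendsto (fun x => (X x).nS s / N x) L (𝓝 (θ.p s)) := by
  simp only [nS_div]
  convert (((hX 0 (by norm_num) true true s).add (hX 0 (by norm_num) false true s)).add
    (hX 0 (by norm_num) true false s)).add (hX 0 (by norm_num) false false s) using 2
  have h1 := hθ.m_zero true s
  have h2 := hθ.m_zero false s
  simp only [armProb, if_true, Bool.false_eq_true, if_false]
  linear_combination (-θ.pi0 * θ.p s) * h1 - ((1 - θ.pi0) * θ.p s) * h2

theorem tendsto_nA_div (hθ : θ.Regular) (hX : MomentsTendsto L X θ)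
    (s : St) :
    Tendsto (fun x => (X x).nA s / N x) L (𝓝 (θ.pi0 * θ.p s)) := by
  simp only [nA_div]
  convert (hX 0 (by norm_num) true true s).add (hX 0 (by norm_num) false true s) using 2
  have h1 := hθ.m_zero true s
  simp only [armProb, if_true]
  linear_combination (-θ.pi0 * θ.p s) * h1

theorem tendsto_nAD_div (hX : MomentsTendsto L X θ)
    (s : St) :
    Tendsto (fun x => (X x).nAD s / N x) L (𝓝 (θ.pi0 * θ.p s * θ.piD true s)) := by
  simp only [nAD_div]
  convert hX 0 (by norm_num) true true s using 2
  simp only [armProb, if_true, LimitCells.piD]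
  ring

theorem tendsto_nD_div (hX : MomentsTendsto L X θ)
    (s : St) :
    Tendsto (fun x => (X x).nD s / N x) L
      (𝓝 (θ.pi0 * θ.p s * θ.piD true s + (1 - θ.pi0) * θ.p s * θ.piD false s)) := by
  simp only [nD_div]
  convert (hX 0 (by norm_num) true true s).add (hX 0 (by norm_num) true false s) using 2
  simp only [armProb, if_true, LimitCells.piD, Bool.false_eq_true, if_false]
  ring

theorem tendsto_sumY_div (hX : MomentsTendsto L X θ)
    (s : St) :
    Tendsto (fun x => (X x).sumY s / N x) L
      (𝓝 (θ.pi0 * θ.p s * θ.mean true s + (1 - θ.pi0) * θ.p s * θ.mean false s)) := by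
  simp only [sumY_div]
  convert (((hX 1 (by norm_num) true true s).add (hX 1 (by norm_num) false true s)).add
    (hX 1 (by norm_num) true false s)).add (hX 1 (by norm_num) false false s) using 2
  simp only [armProb, if_true, LimitCells.mean, Bool.false_eq_true, if_false]
  ring

theorem tendsto_sumAY_div (hX : MomentsTendsto L X θ)
    (s : St) :
    Tendsto (fun x => (X x).sumAY s / N x) L (𝓝 (θ.pi0 * θ.p s * θ.mean true s)) := by
  simp only [sumAY_div]
  convert (hX 1 (by norm_num) true true s).add (hX 1 (by norm_num) false true s) using 2
  simp only [armProb, if_true, LimitCells.mean]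
  ring

theorem tendsto_nA_div_nS' (hθ : θ.Regular) (hX : MomentsTendsto L X θ) (hN : ∀ᶠ x in L, N x ≠ 0)
    (s : St) :
    Tendsto (fun x => (X x).nA s / (X x).nS s) L (𝓝 θ.pi0) := by
  have hp := (hθ.p_pos s).ne'
  have h := (tendsto_nA_div hθ hX s).div (tendsto_nS_div' hθ hX s) hp
  rw [mul_div_cancel_right₀ _ hp] at h
  refine h.congr' ?_
  filter_upwards [hN] with x hx
  exact div_div_div_cancel_right₀ (Nat.cast_ne_zero.2 hx) _ _

theorem tendsto_nS_div_nA (hθ : θ.Regular) (hX : MomentsTendsto L X θ) (hN : ∀ᶠ x in L, N x ≠ 0)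
    (s : St) :
    Tendsto (fun x => (X x).nS s / (X x).nA s) L (𝓝 (1 / θ.pi0)) := by
  have h := (tendsto_nA_div_nS' hθ hX hN s).inv₀ hθ.pi0_mem.1.ne'
  simpa using h

theorem tendsto_nS_div_sub (hθ : θ.Regular) (hX : MomentsTendsto L X θ) (hN : ∀ᶠ x in L, N x ≠ 0)
    (s : St) :
    Tendsto (fun x => (X x).nS s / ((X x).nS s - (X x).nA s)) L (𝓝 (1 / (1 - θ.pi0))) := by
  have hp := (hθ.p_pos s).ne'
  have hq : 1 - θ.pi0 ≠ 0 := (sub_pos.2 hθ.pi0_mem.2).ne'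
  have hd : θ.p s - θ.pi0 * θ.p s ≠ 0 := by
    rw [show θ.p s - θ.pi0 * θ.p s = (1 - θ.pi0) * θ.p s by ring]
    exact mul_ne_zero hq hp
  have h := (tendsto_nS_div' hθ hX s).div
    ((tendsto_nS_div' hθ hX s).sub (tendsto_nA_div hθ hX s)) hd
  rw [show θ.p s / (θ.p s - θ.pi0 * θ.p s) = 1 / (1 - θ.pi0) by field_simp] at h
  refine h.congr' ?_
  filter_upwards [hN] with x hx
  rw [Pi.div_apply, ← sub_div]
  exact div_div_div_cancel_right₀ (Nat.cast_ne_zero.2 hx) _ _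

theorem tendsto_piD1hat (hθ : θ.Regular) (hX : MomentsTendsto L X θ) (hN : ∀ᶠ x in L, N x ≠ 0)
    (s : St) :
    Tendsto (fun x => (X x).piD1hat s) L (𝓝 (θ.piD true s)) := by
  have hp := (hθ.p_pos s).ne'
  have h0 := hθ.pi0_mem.1.ne'
  have h := (tendsto_nAD_div hX s).div (tendsto_nA_div hθ hX s) (mul_ne_zero h0 hp)
  rw [mul_div_cancel_left₀ _ (mul_ne_zero h0 hp)] at h
  refine h.congr' ?_
  filter_upwards [hN] with x hx
  exact div_div_div_cancel_right₀ (Nat.cast_ne_zero.2 hx) _ _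

theorem tendsto_piD0hat (hθ : θ.Regular) (hX : MomentsTendsto L X θ) (hN : ∀ᶠ x in L, N x ≠ 0)
    (s : St) :
    Tendsto (fun x => (X x).piD0hat s) L (𝓝 (θ.piD false s)) := by
  have hp := (hθ.p_pos s).ne'
  have hq : 1 - θ.pi0 ≠ 0 := (sub_pos.2 hθ.pi0_mem.2).ne'
  have hd : θ.p s - θ.pi0 * θ.p s ≠ 0 := by
    rw [show θ.p s - θ.pi0 * θ.p s = (1 - θ.pi0) * θ.p s by ring]
    exact mul_ne_zero hq hp
  have h := ((tendsto_nD_div hX s).sub (tendsto_nAD_div hX s)).div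
    ((tendsto_nS_div' hθ hX s).sub (tendsto_nA_div hθ hX s)) hd
  rw [show (θ.pi0 * θ.p s * θ.piD true s + (1 - θ.pi0) * θ.p s * θ.piD false s
    - θ.pi0 * θ.p s * θ.piD true s) / (θ.p s - θ.pi0 * θ.p s) = θ.piD false s by
      rw [div_eq_iff hd]; ring] at h
  refine h.congr' ?_
  filter_upwards [hN] with x hx
  rw [Pi.div_apply, ← sub_div, ← sub_div]
  exact div_div_div_cancel_right₀ (Nat.cast_ne_zero.2 hx) _ _

theorem tendsto_blockDet_div (hθ : θ.Regular) (hX : MomentsTendsto L X θ)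
    (s : St) :
    Tendsto (fun x => (X x).blockDet s / (N x : ℝ) ^ 2) L
      (𝓝 (θ.p s ^ 2 * (θ.pi0 * (1 - θ.pi0)) * (θ.piD true s - θ.piD false s))) := by
  have h := ((tendsto_nS_div' hθ hX s).mul (tendsto_nAD_div hX s)).sub
    ((tendsto_nD_div hX s).mul (tendsto_nA_div hθ hX s))
  convert h using 2
  · rw [blockDet]
    ring
  · ring

theorem blockDet_limit_ne (hθ : θ.Regular)
    (s : St) :
    θ.p s ^ 2 * (θ.pi0 * (1 - θ.pi0)) * (θ.piD true s - θ.piD false s) ≠ 0 := by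
  have hp := hθ.p_pos s
  have h0 := hθ.pi0_mem.1
  have h1 := sub_pos.2 hθ.pi0_mem.2
  have hd := hθ.piD_lt s
  positivity

/-- The scaled block determinants have nonzero limits, so the convention for a singular `Z'X` is
asymptotically irrelevant. -/
theorem eventually_blockDet_ne (hθ : θ.Regular) (hX : MomentsTendsto L X θ)
    : ∀ᶠ x in L, ∀ s, (X x).blockDet s ≠ 0 := by
  rw [eventually_all]
  intro s
  filter_upwards [(tendsto_blockDet_div hθ hX s).eventually_ne (blockDet_limit_ne hθ s)]
    with x hx h
  exact hx (by rw [h, zero_div])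

/-- Numerator and denominator of Cramer's rule are divided by `n ^ 2`; the common factor `p(s) ^ 2
π_A (1 - π_A)` cancels and leaves the Wald ratio. -/
theorem tendsto_betaSatIn (hθ : θ.Regular) (hX : MomentsTendsto L X θ) (hN : ∀ᶠ x in L, N x ≠ 0)
    (s : St) :
    Tendsto (fun x => (X x).betaSatIn s) L (𝓝 (θ.beta s)) := by
  have h := (((tendsto_nS_div' hθ hX s).mul (tendsto_sumAY_div hX s)).sub
    ((tendsto_nA_div hθ hX s).mul (tendsto_sumY_div hX s))).div
    (tendsto_blockDet_div hθ hX s) (blockDet_limit_ne hθ s)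
  have hlim : (θ.p s * (θ.pi0 * θ.p s * θ.mean true s) - θ.pi0 * θ.p s *
      (θ.pi0 * θ.p s * θ.mean true s + (1 - θ.pi0) * θ.p s * θ.mean false s))
      / (θ.p s ^ 2 * (θ.pi0 * (1 - θ.pi0)) * (θ.piD true s - θ.piD false s)) = θ.beta s := by
    have hd := (hθ.piD_lt s).ne'
    rw [div_eq_iff (blockDet_limit_ne hθ s), LimitCells.beta]
    field_simp
    ring
  rw [hlim] at h
  refine h.congr' ?_
  filter_upwards [hN, eventually_blockDet_ne hθ hX] with x hx hdet
  have hx' : (N x : ℝ) ≠ 0 := Nat.cast_ne_zero.2 hx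
  rw [betaSatIn, coefSat_eq _ hdet, Sum.elim_inr, Pi.div_apply]
  have := hdet s
  field_simp

theorem tendsto_gammaSatHat (hθ : θ.Regular) (hX : MomentsTendsto L X θ) (hN : ∀ᶠ x in L, N x ≠ 0)
    (s : St) :
    Tendsto (fun x => (X x).gammaSatHat s) L (𝓝 (θ.gamma s)) := by
  have h := (((tendsto_sumY_div hX s).mul (tendsto_nAD_div hX s)).sub
    ((tendsto_nD_div hX s).mul (tendsto_sumAY_div hX s))).div
    (tendsto_blockDet_div hθ hX s) (blockDet_limit_ne hθ s)
  have hlim : ((θ.pi0 * θ.p s * θ.mean true s + (1 - θ.pi0) * θ.p s * θ.mean false s)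
        * (θ.pi0 * θ.p s * θ.piD true s)
      - (θ.pi0 * θ.p s * θ.piD true s + (1 - θ.pi0) * θ.p s * θ.piD false s)
        * (θ.pi0 * θ.p s * θ.mean true s))
      / (θ.p s ^ 2 * (θ.pi0 * (1 - θ.pi0)) * (θ.piD true s - θ.piD false s)) = θ.gamma s := by
    have hd := (hθ.piD_lt s).ne'
    rw [div_eq_iff (blockDet_limit_ne hθ s), LimitCells.gamma, LimitCells.beta]
    field_simp
    ring
  rw [hlim] at h
  refine h.congr' ?_
  filter_upwards [hN, eventually_blockDet_ne hθ hX] with x hx hdet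
  have hx' : (N x : ℝ) ≠ 0 := Nat.cast_ne_zero.2 hx
  rw [gammaSatHat, coefSat_eq _ hdet, Sum.elim_inl, Pi.div_apply]
  have := hdet s
  field_simp

theorem tendsto_probCHat (hθ : θ.Regular) (hX : MomentsTendsto L X θ) (hN : ∀ᶠ x in L, N x ≠ 0)
    : Tendsto (fun x => (X x).probCHat) L (𝓝 θ.probC) :=
  tendsto_finsetSum _ fun s _ => (tendsto_nS_div' hθ hX s).mul
    ((tendsto_piD1hat hθ hX hN s).sub (tendsto_piD0hat hθ hX hN s))

theorem tendsto_betaSat (hθ : θ.Regular) (hX : MomentsTendsto L X θ) (hN : ∀ᶠ x in L, N x ≠ 0)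
    : Tendsto (fun x => (X x).betaSat) L (𝓝 θ.betaAll) :=
  tendsto_finsetSum _ fun s _ => (((tendsto_nS_div' hθ hX s).mul
    ((tendsto_piD1hat hθ hX hN s).sub (tendsto_piD0hat hθ hX hN s))).div
    (tendsto_probCHat hθ hX hN) hθ.probC_ne).mul (tendsto_betaSatIn hθ hX hN s)

theorem tendsto_cellSq (hθ : θ.Regular) (hX : MomentsTendsto L X θ) (hN : ∀ᶠ x in L, N x ≠ 0)
    (d a : Bool) (s : St) {c : ι → ℝ} {c₀ : ℝ} (hc : Tendsto c L (𝓝 c₀)) :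
    Tendsto (fun x => (X x).cellSq d a s (c x)) L
      (𝓝 (armProb θ.pi0 a * (θ.p s * θ.cellSq d a s c₀))) := by
  simp only [cellSq_eq]
  have hk := (hc.sub (tendsto_gammaSatHat hθ hX hN s)).sub
    ((tendsto_betaSatIn hθ hX hN s).const_mul (num d))
  convert ((hX 2 le_rfl d a s).add ((hk.const_mul 2).mul (hX 1 (by norm_num) d a s))).add
    ((hk.pow 2).mul (hX 0 (by norm_num) d a s)) using 2
  rw [LimitCells.cellSq]
  ring

/-- Continuity of the formula at the limit, where every denominator is nonzero by regularity. -/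
theorem tendsto_VsfeHat (hθ : θ.Regular) (hX : MomentsTendsto L X θ) (hN : ∀ᶠ x in L, N x ≠ 0)
    (tau : St → ℝ) :
    Tendsto (fun x => (X x).VsfeHat tau) L (𝓝 (θ.Vsfe tau)) := by
  have hC := (tendsto_const_nhds (x := (1 : ℝ))).div ((tendsto_probCHat hθ hX hN).pow 2)
    (pow_ne_zero 2 hθ.probC_ne)
  have hδ := fun s => (tendsto_betaSatIn hθ hX hN s).sub (tendsto_betaSat hθ hX hN)
  have h1 := tendsto_piD1hat hθ hX hN
  have h0 := tendsto_piD0hat hθ hX hN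
  have hS := tendsto_nS_div' hθ hX
  have hr := tendsto_nA_div_nS' hθ hX hN
  have hq : θ.pi0 * (1 - θ.pi0) ≠ 0 :=
    mul_ne_zero hθ.pi0_mem.1.ne' (sub_pos.2 hθ.pi0_mem.2).ne'
  refine Tendsto.add (Tendsto.add (Tendsto.add ?_ ?_) ?_) ?_
  · refine hC.mul (tendsto_finsetSum _ fun s _ => ((tendsto_nS_div_nA hθ hX hN s).pow 2).mul ?_)
    convert (tendsto_cellSq hθ hX hN true true s (((h1 s).const_sub 1).mul (hδ s))).add
      (tendsto_cellSq hθ hX hN false true s ((h1 s).mul (hδ s)).neg) using 2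
    simp only [armProb, if_true, LimitCells.armVar]
    ring
  · refine hC.mul (tendsto_finsetSum _ fun s _ => ((tendsto_nS_div_sub hθ hX hN s).pow 2).mul ?_)
    convert (tendsto_cellSq hθ hX hN true false s (((h0 s).const_sub 1).mul (hδ s))).add
      (tendsto_cellSq hθ hX hN false false s ((h0 s).mul (hδ s)).neg) using 2
    simp only [armProb, Bool.false_eq_true, if_false, LimitCells.armVar]
    ring
  · exact hC.mul (tendsto_finsetSum _ fun s _ =>
      ((hS s).mul (((h1 s).sub (h0 s)).pow 2)).mul ((hδ s).pow 2))
  · exact hC.mul (tendsto_finsetSum _ fun s _ =>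
      ((((hS s).mul_const (tau s)).mul ((((hr s).const_mul 2).const_sub 1).pow 2 |>.div
        ((hr s).mul ((hr s).const_sub 1)) hq)).mul (((h1 s).sub (h0 s)).pow 2)).mul
        ((hδ s).pow 2))

end Limits

end Obs

end CARLate

namespace CARLate

/-! ### The limits of the cell moments in the population -/

section Population

variable {Zc St : Type*} [MeasurableSpace Zc] [Fintype St] [DecidableEq St]
  [MeasurableSpace St] [MeasurableSingletonClass St]
  {Q : Measure (Primitive Zc)} [IsProbabilityMeasure Q] {S : Zc → St}

theorem measurableSet_compliers : MeasurableSet (compliers (Zc := Zc)) :=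
  (measurable_potD false (measurableSet_singleton false)).inter
    (measurable_potD true (measurableSet_singleton true))

theorem measurableSet_alwaysTakers : MeasurableSet (alwaysTakers (Zc := Zc)) :=
  (measurable_potD false (measurableSet_singleton true)).inter
    (measurable_potD true (measurableSet_singleton true))

theorem measurableSet_neverTakers : MeasurableSet (neverTakers (Zc := Zc)) :=
  (measurable_potD false (measurableSet_singleton false)).inter
    (measurable_potD true (measurableSet_singleton false))

/-- Without defiers the three types partition the stratum up to a null set. -/
theorem setIntegral_inStratum_eq (hS : Measurable S) (hdef : Q defiers = 0) (s : St)
    {g : Primitive Zc → ℝ} (hg : Integrable g Q) :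
    ∫ w in inStratum S s, g w ∂Q = (∫ w in alwaysTakers ∩ inStratum S s, g w ∂Q)
      + (∫ w in compliers ∩ inStratum S s, g w ∂Q)
      + ∫ w in neverTakers ∩ inStratum S s, g w ∂Q := by
  have hs := measurableSet_inStratum hS s
  have hC := measurableSet_compliers (Zc := Zc)
  have hN := measurableSet_neverTakers (Zc := Zc)
  rw [← setIntegral_union ?_ (hC.inter hs) hg.integrableOn hg.integrableOn,
    ← setIntegral_union ?_ (hN.inter hs) hg.integrableOn hg.integrableOn]
  · refine setIntegral_congr_set ?_
    have hnd : ∀ᵐ w ∂Q, w ∉ defiers := measure_eq_zero_iff_ae_notMem.1 hdef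
    filter_upwards [hnd] with w hw
    refine propext ⟨fun h => ?_, fun h => ?_⟩
    · change w ∈ (alwaysTakers ∩ inStratum S s) ∪ (compliers ∩ inStratum S s)
        ∪ (neverTakers ∩ inStratum S s)
      simp only [defiers, Set.mem_ofPred_eq] at hw
      simp only [Set.mem_union, Set.mem_inter_iff, alwaysTakers, compliers, neverTakers,
        Set.mem_ofPred_eq]
      have h' : w ∈ inStratum S s := h
      cases h0 : potD false w <;> cases h1 : potD true w <;> simp_all
    · rcases h with (h | h) | h <;> exact h.2
  · rw [Set.disjoint_left]
    intro w hw hw'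
    have h' : potD true w = false := hw'.1.2
    rcases hw with hw | hw
    · exact absurd (hw.1.2.symm.trans h') (by simp)
    · exact absurd (hw.1.2.symm.trans h') (by simp)
  · rw [Set.disjoint_left]
    intro w hw hw'
    exact absurd (hw.1.1.symm.trans hw'.1.1) (by simp)

/-- `Y(d)^k I{D(a) = d}`. -/
def cellFun (k : ℕ) (d a : Bool) (w : Primitive Zc) : ℝ :=
  if potD a w = d then potY d w ^ k else 0

theorem measurable_cellFun (k : ℕ) (d a : Bool) : Measurable (cellFun (Zc := Zc) k d a) :=
  Measurable.ite (measurable_potD a (measurableSet_singleton d)) ((measurable_potY d).pow_const k)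
    measurable_const

theorem memLp_potY (h2 : ∀ d, Integrable (fun w => potY d w ^ 2) Q) (d : Bool) :
    MemLp (potY d) 2 Q :=
  (memLp_two_iff_integrable_sq (measurable_potY d).aestronglyMeasurable).2 (h2 d)

theorem integrable_potY_pow (h2 : ∀ d, Integrable (fun w => potY d w ^ 2) Q) (d : Bool) {k : ℕ}
    (hk : k ≤ 2) : Integrable (fun w => potY d w ^ k) Q := by
  interval_cases k
  · simp
  · simpa using (memLp_potY h2 d).integrable (by norm_num)
  · exact h2 d

theorem integrable_cellFun (h2 : ∀ d, Integrable (fun w => potY d w ^ 2) Q) {k : ℕ}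
    (hk : k ≤ 2) (d a : Bool) : Integrable (cellFun k d a) Q := by
  refine (integrable_potY_pow h2 d hk).mono (measurable_cellFun k d a).aestronglyMeasurable
    (Eventually.of_forall fun w => ?_)
  unfold cellFun
  split_ifs <;> simp

/-- The limits of the cell moments. -/
def limitCells (Q : Measure (Primitive Zc)) (S : Zc → St) (pi0 : ℝ) : Obs.LimitCells St where
  pi0 := pi0
  p := p Q S
  m k d a s := (∫ w in inStratum S s, cellFun k d a w ∂Q) / p Q S s

theorem limitCells_piD (hS : Measurable S) (pi0 : ℝ) (a : Bool) (s : St) :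
    (limitCells Q S pi0).piD a s = piD Q S a s := by
  have hs := measurableSet_inStratum hS s
  have hD : MeasurableSet {w : Primitive Zc | potD a w = true} :=
    measurable_potD a (measurableSet_singleton true)
  have h : ∀ w : Primitive Zc, cellFun 0 true a w
      = {w : Primitive Zc | potD a w = true}.indicator (fun _ => (1 : ℝ)) w := by
    intro w
    by_cases hw : potD a w = true <;> simp [cellFun, hw]
  simp only [Obs.LimitCells.piD, limitCells, piD, h]
  rw [integral_indicator hD, Measure.restrict_restrict hD, setIntegral_const, smul_eq_mul, mul_one,
    Measure.real, Measure.real, ProbabilityTheory.cond_apply hs, ENNReal.toReal_mul,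
    ENNReal.toReal_inv, Set.inter_comm, p, Measure.real, div_eq_inv_mul]

theorem integrable_cond {f : Primitive Zc → ℝ} (hf : Integrable f Q)
    (E : Set (Primitive Zc)) : Integrable f (ProbabilityTheory.cond Q E) := by
  by_cases h : Q E = 0
  · rw [ProbabilityTheory.cond_eq_zero_of_meas_eq_zero h]
    exact integrable_zero_measure
  · exact hf.restrict.smul_measure (ENNReal.inv_ne_top.2 h)

theorem setIntegral_potY (d : Bool) (T : Set (Primitive Zc)) (s : St) :
    ∫ w in T ∩ inStratum S s, potY d w ^ 1 ∂Q
      = Q.real (T ∩ inStratum S s) * meanIn Q S d T s := by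
  simp_rw [pow_one]
  exact setIntegral_eq_real_mul_cond _

/-- Second moment as variance plus squared mean; for an empty type both sides are zero, in
accordance with the convention for null events. -/
theorem setIntegral_potY_sq (h2 : ∀ d, Integrable (fun w => potY d w ^ 2) Q) (d : Bool)
    (T : Set (Primitive Zc)) (s : St) :
    ∫ w in T ∩ inStratum S s, potY d w ^ 2 ∂Q
      = Q.real (T ∩ inStratum S s) * (varIn Q S d T s + meanIn Q S d T s ^ 2) := by
  rw [setIntegral_eq_real_mul_cond]
  by_cases h : Q (T ∩ inStratum S s) = 0
  · simp [Measure.real, h]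
  · have := ProbabilityTheory.cond_isProbabilityMeasure h
    have hL : MemLp (potY d) 2 (ProbabilityTheory.cond Q (T ∩ inStratum S s)) :=
      (memLp_two_iff_integrable_sq (measurable_potY d).aestronglyMeasurable).2
        (integrable_cond (h2 d) _)
    have hv := variance_eq_sub hL
    simp only [Pi.pow_apply] at hv
    rw [varIn, condVar, hv, meanIn, condMean, sub_add_cancel]

theorem setIntegral_potY_zero (d : Bool) (T : Set (Primitive Zc)) (s : St) :
    ∫ w in T ∩ inStratum S s, potY d w ^ 0 ∂Q = Q.real (T ∩ inStratum S s) := by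
  simp

theorem setIntegral_cellFun_eq {k : ℕ} {d a : Bool} {T : Set (Primitive Zc)} {s : St}
    (hS : Measurable S) (hT : MeasurableSet T) (h : ∀ w ∈ T, potD a w = d) :
    ∫ w in T ∩ inStratum S s, cellFun k d a w ∂Q
      = ∫ w in T ∩ inStratum S s, potY d w ^ k ∂Q :=
  setIntegral_congr_fun (hT.inter (measurableSet_inStratum hS s)) fun w hw => if_pos (h w hw.1)

theorem setIntegral_cellFun_eq_zero {k : ℕ} {d a : Bool} {T : Set (Primitive Zc)} {s : St}
    (h : ∀ w ∈ T, potD a w = !d) :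
    ∫ w in T ∩ inStratum S s, cellFun k d a w ∂Q = 0 :=
  setIntegral_eq_zero_of_forall_eq_zero fun w hw => if_neg (by rw [h w hw.1]; cases d <;> simp)

/-- Here and in the next three lemmas, arm and treatment decision determine which types populate the
cell: two types when `d = a`, a single one otherwise. -/
theorem setIntegral_cellFun_true_true (hS : Measurable S) (hdef : Q defiers = 0)
    (h2 : ∀ d, Integrable (fun w => potY d w ^ 2) Q) {k : ℕ} (hk : k ≤ 2) (s : St) :
    ∫ w in inStratum S s, cellFun k true true w ∂Q
      = (∫ w in alwaysTakers ∩ inStratum S s, potY true w ^ k ∂Q)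
        + ∫ w in compliers ∩ inStratum S s, potY true w ^ k ∂Q := by
  rw [setIntegral_inStratum_eq hS hdef s (integrable_cellFun h2 hk _ _),
    setIntegral_cellFun_eq hS measurableSet_alwaysTakers fun w hw => hw.2,
    setIntegral_cellFun_eq hS measurableSet_compliers fun w hw => hw.2,
    setIntegral_cellFun_eq_zero fun w (hw : w ∈ neverTakers) => hw.2, add_zero]

theorem setIntegral_cellFun_false_true (hS : Measurable S) (hdef : Q defiers = 0)
    (h2 : ∀ d, Integrable (fun w => potY d w ^ 2) Q) {k : ℕ} (hk : k ≤ 2) (s : St) :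
    ∫ w in inStratum S s, cellFun k false true w ∂Q
      = ∫ w in neverTakers ∩ inStratum S s, potY false w ^ k ∂Q := by
  rw [setIntegral_inStratum_eq hS hdef s (integrable_cellFun h2 hk _ _),
    setIntegral_cellFun_eq_zero fun w (hw : w ∈ alwaysTakers) => hw.2,
    setIntegral_cellFun_eq_zero fun w (hw : w ∈ compliers) => hw.2,
    setIntegral_cellFun_eq hS measurableSet_neverTakers fun w hw => hw.2, add_zero, zero_add]

theorem setIntegral_cellFun_true_false (hS : Measurable S) (hdef : Q defiers = 0)
    (h2 : ∀ d, Integrable (fun w => potY d w ^ 2) Q) {k : ℕ} (hk : k ≤ 2) (s : St) :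
    ∫ w in inStratum S s, cellFun k true false w ∂Q
      = ∫ w in alwaysTakers ∩ inStratum S s, potY true w ^ k ∂Q := by
  rw [setIntegral_inStratum_eq hS hdef s (integrable_cellFun h2 hk _ _),
    setIntegral_cellFun_eq hS measurableSet_alwaysTakers fun w hw => hw.1,
    setIntegral_cellFun_eq_zero fun w (hw : w ∈ compliers) => hw.1,
    setIntegral_cellFun_eq_zero fun w (hw : w ∈ neverTakers) => hw.1, add_zero, add_zero]

theorem setIntegral_cellFun_false_false (hS : Measurable S) (hdef : Q defiers = 0)
    (h2 : ∀ d, Integrable (fun w => potY d w ^ 2) Q) {k : ℕ} (hk : k ≤ 2) (s : St) :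
    ∫ w in inStratum S s, cellFun k false false w ∂Q
      = (∫ w in compliers ∩ inStratum S s, potY false w ^ k ∂Q)
        + ∫ w in neverTakers ∩ inStratum S s, potY false w ^ k ∂Q := by
  rw [setIntegral_inStratum_eq hS hdef s (integrable_cellFun h2 hk _ _),
    setIntegral_cellFun_eq_zero fun w (hw : w ∈ alwaysTakers) => hw.1,
    setIntegral_cellFun_eq hS measurableSet_compliers fun w hw => hw.1,
    setIntegral_cellFun_eq hS measurableSet_neverTakers fun w hw => hw.1, zero_add]

theorem limitCells_m_zero {s : St} (hs : 0 < p Q S s) (pi0 : ℝ) (a : Bool) :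
    (limitCells Q S pi0).m 0 true a s + (limitCells Q S pi0).m 0 false a s = 1 := by
  have h0 : ∀ d, Integrable (cellFun 0 d a) Q := fun d =>
    Integrable.of_bound (measurable_cellFun 0 d a).aestronglyMeasurable 1
      (Eventually.of_forall fun w => by unfold cellFun; split_ifs <;> simp)
  have h : ∀ w : Primitive Zc, cellFun 0 true a w + cellFun 0 false a w = 1 := by
    intro w
    cases hw : potD a w <;> simp [cellFun, hw]
  simp only [limitCells]
  rw [← add_div, ← integral_add (h0 true).integrableOn (h0 false).integrableOn]
  simp_rw [h]
  rw [div_eq_one_iff_eq hs.ne']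
  simp [p]

/-- The probabilities of the types within a stratum. -/
structure TypeProbs (Q : Measure (Primitive Zc)) (S : Zc → St) (s : St) : Prop where
  always : Q.real (alwaysTakers ∩ inStratum S s) = p Q S s * piD Q S false s
  comply : Q.real (compliers ∩ inStratum S s) = p Q S s * (piD Q S true s - piD Q S false s)
  never : Q.real (neverTakers ∩ inStratum S s) = p Q S s * (1 - piD Q S true s)

/-- The zeroth cell moments are type probabilities: those treated in the control arm are always
takers, those untreated in the treatment arm are never takers, and compliers make up the rest. -/
theorem typeProbs (hS : Measurable S) (hdef : Q defiers = 0)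
    (h2 : ∀ d, Integrable (fun w => potY d w ^ 2) Q) {s : St} (hs : 0 < p Q S s) :
    TypeProbs Q S s := by
  -- The value `0` for the target proportion is a dummy; the moments do not involve it.
  have e1 := limitCells_piD (Q := Q) hS 0 true s
  have e0 := limitCells_piD (Q := Q) hS 0 false s
  have e2 := limitCells_m_zero (Q := Q) hs 0 true
  simp only [Obs.LimitCells.piD, limitCells] at e1 e0 e2
  rw [setIntegral_cellFun_true_true hS hdef h2 (by norm_num)] at e1 e2
  rw [setIntegral_cellFun_false_true hS hdef h2 (by norm_num)] at e2
  rw [setIntegral_cellFun_true_false hS hdef h2 (by norm_num)] at e0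
  simp only [setIntegral_potY_zero] at e1 e0 e2
  rw [e1] at e2
  have e3 := eq_sub_of_add_eq' e2
  rw [div_eq_iff hs.ne'] at e0 e1 e3
  exact ⟨by linarith, by linarith, by linarith⟩

/-- The limits of the cell moments in terms of conditional means and variances. -/
structure CellValues (Q : Measure (Primitive Zc)) (S : Zc → St) (pi0 : ℝ) (s : St) : Prop where
  one_tt : (limitCells Q S pi0).m 1 true true s = piD Q S false s * meanIn Q S true alwaysTakers s
    + (piD Q S true s - piD Q S false s) * meanIn Q S true compliers s
  one_ft : (limitCells Q S pi0).m 1 false true s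
    = (1 - piD Q S true s) * meanIn Q S false neverTakers s
  one_tf : (limitCells Q S pi0).m 1 true false s
    = piD Q S false s * meanIn Q S true alwaysTakers s
  one_ff : (limitCells Q S pi0).m 1 false false s
    = (piD Q S true s - piD Q S false s) * meanIn Q S false compliers s
      + (1 - piD Q S true s) * meanIn Q S false neverTakers s
  two_tt : (limitCells Q S pi0).m 2 true true s
    = piD Q S false s * (varIn Q S true alwaysTakers s + meanIn Q S true alwaysTakers s ^ 2)
      + (piD Q S true s - piD Q S false s)
        * (varIn Q S true compliers s + meanIn Q S true compliers s ^ 2)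
  two_ft : (limitCells Q S pi0).m 2 false true s
    = (1 - piD Q S true s)
      * (varIn Q S false neverTakers s + meanIn Q S false neverTakers s ^ 2)
  two_tf : (limitCells Q S pi0).m 2 true false s
    = piD Q S false s * (varIn Q S true alwaysTakers s + meanIn Q S true alwaysTakers s ^ 2)
  two_ff : (limitCells Q S pi0).m 2 false false s
    = (piD Q S true s - piD Q S false s)
        * (varIn Q S false compliers s + meanIn Q S false compliers s ^ 2)
      + (1 - piD Q S true s)
        * (varIn Q S false neverTakers s + meanIn Q S false neverTakers s ^ 2)

theorem cellValues (hS : Measurable S) (hdef : Q defiers = 0)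
    (h2 : ∀ d, Integrable (fun w => potY d w ^ 2) Q) {s : St} (hs : 0 < p Q S s) (pi0 : ℝ) :
    CellValues Q S pi0 s := by
  obtain ⟨hA, hC, hN⟩ := typeProbs hS hdef h2 hs
  constructor <;> simp only [limitCells] <;> rw [div_eq_iff hs.ne']
  · rw [setIntegral_cellFun_true_true hS hdef h2 (by norm_num), setIntegral_potY,
      setIntegral_potY, hA, hC]
    ring
  · rw [setIntegral_cellFun_false_true hS hdef h2 (by norm_num), setIntegral_potY, hN]
    ring
  · rw [setIntegral_cellFun_true_false hS hdef h2 (by norm_num), setIntegral_potY, hA]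
    ring
  · rw [setIntegral_cellFun_false_false hS hdef h2 (by norm_num), setIntegral_potY,
      setIntegral_potY, hC, hN]
    ring
  · rw [setIntegral_cellFun_true_true hS hdef h2 le_rfl, setIntegral_potY_sq h2,
      setIntegral_potY_sq h2, hA, hC]
    ring
  · rw [setIntegral_cellFun_false_true hS hdef h2 le_rfl, setIntegral_potY_sq h2, hN]
    ring
  · rw [setIntegral_cellFun_true_false hS hdef h2 le_rfl, setIntegral_potY_sq h2, hA]
    ring
  · rw [setIntegral_cellFun_false_false hS hdef h2 le_rfl, setIntegral_potY_sq h2,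
      setIntegral_potY_sq h2, hC, hN]
    ring

theorem lateIn_eq (h2 : ∀ d, Integrable (fun w => potY d w ^ 2) Q) (s : St) :
    lateIn Q S s = meanIn Q S true compliers s - meanIn Q S false compliers s := by
  have h : ∀ d, Integrable (potY d) Q := fun d => (memLp_potY h2 d).integrable (by norm_num)
  exact integral_sub (integrable_cond (h true) _) (integrable_cond (h false) _)

/-- Both sides are the integral of `Y(1) - Y(0)` over the compliers, the right one split by strata.
-/
theorem probC_mul_late (hS : Measurable S) (hdef : Q defiers = 0)
    (h2 : ∀ d, Integrable (fun w => potY d w ^ 2) Q) (hs : ∀ s, 0 < p Q S s) :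
    probC Q S * late Q
      = ∑ s, p Q S s * (piD Q S true s - piD Q S false s) * lateIn Q S s := by
  have h : ∀ d, Integrable (potY d) Q := fun d => (memLp_potY h2 d).integrable (by norm_num)
  have hU : (⋃ s, compliers ∩ inStratum S s) = compliers (Zc := Zc) := by
    rw [← Set.inter_iUnion, Set.inter_eq_left]
    exact fun w _ => Set.mem_iUnion.2 ⟨_, rfl⟩
  have hsplit : ∀ f : Primitive Zc → ℝ, Integrable f Q →
      ∫ w in compliers, f w ∂Q = ∑ s, ∫ w in compliers ∩ inStratum S s, f w ∂Q := by
    intro f hf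
    rw [← integral_iUnion_fintype
      (fun s => measurableSet_compliers.inter (measurableSet_inStratum hS s)) ?_
      fun s => hf.integrableOn, hU]
    intro s t hst
    exact Set.disjoint_left.2 fun w h1 h2 => hst (Eq.trans (Eq.symm h1.2) h2.2)
  have hC : Q.real compliers = probC Q S := by
    have := hsplit (fun _ => 1) (integrable_const _)
    simp only [integral_const, smul_eq_mul, mul_one, measureReal_restrict_apply_univ] at this
    rw [this, probC]
    exact Finset.sum_congr rfl fun s _ => (typeProbs hS hdef h2 (hs s)).comply
  have hl := setIntegral_eq_real_mul_cond (μ := Q) (E := compliers)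
    fun w => potY true w - potY false w
  rw [hC] at hl
  refine hl.symm.trans ?_
  rw [hsplit (fun w => potY true w - potY false w) ((h true).sub (h false))]
  refine Finset.sum_congr rfl fun s _ => ?_
  rw [setIntegral_eq_real_mul_cond, (typeProbs hS hdef h2 (hs s)).comply]
  rfl

/-- The assumptions on the marginal distribution of the sample. -/
structure PopulationAssumption (Q : Measure (Primitive Zc)) (S : Zc → St) : Prop where
  secondMoment : ∀ d, Integrable (fun w => potY d w ^ 2) Q
  strata_pos : ∀ s, 0 < p Q S s
  no_defiers : Q defiers = 0
  compliers_pos : ∀ s, 0 < piD Q S true s - piD Q S false s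

/-- LATE identification: always and never takers contribute equally to both arm means, so the
difference of the means comes from compliers alone. -/
theorem limitCells_beta (hS : Measurable S) (hQ : PopulationAssumption Q S) (pi0 : ℝ) (s : St) :
    (limitCells Q S pi0).beta s = lateIn Q S s := by
  have hv := cellValues hS hQ.no_defiers hQ.secondMoment (hQ.strata_pos s) pi0
  rw [Obs.LimitCells.beta, limitCells_piD hS, limitCells_piD hS,
    div_eq_iff (hQ.compliers_pos s).ne', lateIn_eq hQ.secondMoment, Obs.LimitCells.mean,
    Obs.LimitCells.mean, hv.one_tt, hv.one_ft, hv.one_tf, hv.one_ff]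
  ring

theorem limitCells_probC (hS : Measurable S) (pi0 : ℝ) :
    (limitCells Q S pi0).probC = probC Q S := by
  simp only [Obs.LimitCells.probC, limitCells_piD hS]
  rfl

theorem nonempty_strata (S : Zc → St) (Q : Measure (Primitive Zc)) [IsProbabilityMeasure Q] :
    Nonempty St :=
  (nonempty_of_isProbabilityMeasure Q).map fun w => stratum S w

theorem probC_pos (hQ : PopulationAssumption Q S) : 0 < probC Q S :=
  haveI := nonempty_strata S Q
  Finset.sum_pos (fun s _ => mul_pos (hQ.strata_pos s) (hQ.compliers_pos s))
    Finset.univ_nonempty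

theorem limitCells_betaAll (hS : Measurable S) (hQ : PopulationAssumption Q S) (pi0 : ℝ) :
    (limitCells Q S pi0).betaAll = late Q := by
  have h := probC_mul_late hS hQ.no_defiers hQ.secondMoment hQ.strata_pos
  have hC := (probC_pos hQ).ne'
  simp only [Obs.LimitCells.betaAll, limitCells_piD hS, limitCells_probC hS,
    limitCells_beta hS hQ]
  rw [← mul_right_inj' hC, h, Finset.mul_sum]
  refine Finset.sum_congr rfl fun s _ => ?_
  simp only [limitCells]
  field_simp

theorem limitCells_regular (hS : Measurable S) (hQ : PopulationAssumption Q S) {pi0 : ℝ}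
    (h : pi0 ∈ Set.Ioo (0 : ℝ) 1) : (limitCells Q S pi0).Regular where
  pi0_mem := h
  p_pos := hQ.strata_pos
  m_zero a s := limitCells_m_zero (hQ.strata_pos s) pi0 a
  piD_lt s := by
    rw [limitCells_piD hS, limitCells_piD hS]
    exact hQ.compliers_pos s
  probC_ne := by
    rw [limitCells_probC hS]
    exact (probC_pos hQ).ne'

/-! ### Matching the limit with the asymptotic variance -/

theorem piD_nonneg (a : Bool) (s : St) : 0 ≤ piD Q S a s := measureReal_nonneg

theorem piD_le_one (a : Bool) (s : St) (hs : 0 < p Q S s) : piD Q S a s ≤ 1 := by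
  have h : Q (inStratum S s) ≠ 0 := fun h => hs.ne' (by simp [p, Measure.real, h])
  have := ProbabilityTheory.cond_isProbabilityMeasure h
  exact measureReal_le_one

/-- Law of total variance for `Y - β D` over `D` in the treatment arm. Within `D = 1`, always takers
and compliers mix, which produces the squared difference of their means; within `D = 0` there are
only never takers. The last summand is the variance between the two groups. -/
theorem limitCells_armVar_true (hS : Measurable S) (hQ : PopulationAssumption Q S) (pi0 : ℝ)
    (s : St) :
    (limitCells Q S pi0).armVar true s
      = (varIn Q S true alwaysTakers s * piD Q S false s
      + varIn Q S false neverTakers s * (1 - piD Q S true s)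
      + varIn Q S true compliers s * (piD Q S true s - piD Q S false s)
      + (meanIn Q S true compliers s - meanIn Q S true alwaysTakers s) ^ 2
        * (piD Q S false s * (piD Q S true s - piD Q S false s) / piD Q S true s))
      + (1 - piD Q S true s) / piD Q S true s
        * (- piD Q S false s * (meanIn Q S true compliers s - meanIn Q S true alwaysTakers s)
        + piD Q S true s * (meanIn Q S false compliers s - meanIn Q S false neverTakers s)
        + piD Q S true s * (lateIn Q S s - late Q)) ^ 2 := by
  have hv := cellValues hS hQ.no_defiers hQ.secondMoment (hQ.strata_pos s) pi0
  have hz := limitCells_m_zero (hQ.strata_pos s) pi0 true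
  have hd := limitCells_piD (Q := Q) hS pi0 true s
  -- Positive because it exceeds the nonnegative `π_{D(0)}(s)`.
  have hp : piD Q S true s ≠ 0 := by
    have := piD_nonneg (Q := Q) (S := S) false s
    have := hQ.compliers_pos s
    exact (by linarith : 0 < piD Q S true s).ne'
  rw [Obs.LimitCells.piD] at hd
  rw [hd] at hz
  have hz' := eq_sub_of_add_eq' hz
  simp only [Obs.LimitCells.armVar, Obs.LimitCells.cellSq, Obs.LimitCells.gamma,
    Obs.LimitCells.mean, limitCells_beta hS hQ, limitCells_betaAll hS hQ, limitCells_piD hS,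
    lateIn_eq hQ.secondMoment, hv.one_tt, hv.one_ft, hv.two_tt, hv.two_ft, hd, hz', num,
    if_true, Bool.false_eq_true, if_false]
  field_simp
  ring

/-- The same decomposition in the control arm, where the mixed group is `D = 0`, made up of
compliers and never takers. -/
theorem limitCells_armVar_false (hS : Measurable S) (hQ : PopulationAssumption Q S) (pi0 : ℝ)
    (s : St) :
    (limitCells Q S pi0).armVar false s
      = (varIn Q S true alwaysTakers s * piD Q S false s
      + varIn Q S false neverTakers s * (1 - piD Q S true s)
      + varIn Q S false compliers s * (piD Q S true s - piD Q S false s)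
      + (meanIn Q S false compliers s - meanIn Q S false neverTakers s) ^ 2
        * ((1 - piD Q S true s) * (piD Q S true s - piD Q S false s) / (1 - piD Q S false s)))
      + piD Q S false s / (1 - piD Q S false s)
        * (- (1 - piD Q S false s)
          * (meanIn Q S true compliers s - meanIn Q S true alwaysTakers s)
        + (1 - piD Q S true s) * (meanIn Q S false compliers s - meanIn Q S false neverTakers s)
        + (1 - piD Q S false s) * (lateIn Q S s - late Q)) ^ 2 := by
  have hv := cellValues hS hQ.no_defiers hQ.secondMoment (hQ.strata_pos s) pi0
  have hz := limitCells_m_zero (hQ.strata_pos s) pi0 false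
  have hd := limitCells_piD (Q := Q) hS pi0 false s
  have hp : 1 - piD Q S false s ≠ 0 := by
    have := piD_le_one (Q := Q) (S := S) true s (hQ.strata_pos s)
    have := hQ.compliers_pos s
    exact (by linarith : 0 < 1 - piD Q S false s).ne'
  rw [Obs.LimitCells.piD] at hd
  rw [hd] at hz
  have hz' := eq_sub_of_add_eq' hz
  simp only [Obs.LimitCells.armVar, Obs.LimitCells.cellSq, Obs.LimitCells.gamma,
    Obs.LimitCells.mean, limitCells_beta hS hQ, limitCells_betaAll hS hQ, limitCells_piD hS,
    lateIn_eq hQ.secondMoment, hv.one_tt, hv.one_ft, hv.one_tf, hv.one_ff, hv.two_tf, hv.two_ff,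
    hd, hz', num, if_true, Bool.false_eq_true, if_false]
  field_simp
  ring

/-- The terms `V_{Y,a}` and `V_{D,a}` together make up arm `a`, its weight being `(1/π) ^ 2 π = 1/π`
for the probability `π` of that arm. -/
theorem limitCells_Vsfe (hS : Measurable S) (hQ : PopulationAssumption Q S) {pi0 : ℝ}
    (h : pi0 ∈ Set.Ioo (0 : ℝ) 1) {piA : St → ℝ} (hA : ∀ s, piA s = pi0) (tau : St → ℝ) :
    (limitCells Q S pi0).Vsfe tau = Vsfe Q S piA pi0 tau := by
  have h0 := h.1.ne'
  have h1 : 1 - pi0 ≠ 0 := (sub_pos.2 h.2).ne'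
  have e1 : VY1sat Q S piA + VD1sat Q S piA = 1 / probC Q S ^ 2 * ∑ s, (1 / pi0) ^ 2 *
      (pi0 * p Q S s * (limitCells Q S pi0).armVar true s) := by
    rw [VY1sat, VD1sat, ← mul_add, ← Finset.sum_add_distrib]
    congr 1
    refine Finset.sum_congr rfl fun s _ => ?_
    rw [limitCells_armVar_true hS hQ, hA, mul_add]
    field_simp
  have e0 : VY0sat Q S piA + VD0sat Q S piA = 1 / probC Q S ^ 2 * ∑ s, (1 / (1 - pi0)) ^ 2 *
      ((1 - pi0) * p Q S s * (limitCells Q S pi0).armVar false s) := by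
    rw [VY0sat, VD0sat, ← mul_add, ← Finset.sum_add_distrib]
    congr 1
    refine Finset.sum_congr rfl fun s _ => ?_
    rw [limitCells_armVar_false hS hQ, hA]
    have e : ∀ x w : ℝ, (1 / (1 - pi0)) ^ 2 * ((1 - pi0) * x * w) = x / (1 - pi0) * w := by
      intro x w
      field_simp
    rw [e, mul_div_mul_comm (p Q S s) (piD Q S false s)]
    ring
  have eA : VAsfe Q S pi0 tau = 1 / probC Q S ^ 2 * ∑ s, p Q S s * tau s
      * ((1 - 2 * pi0) ^ 2 / (pi0 * (1 - pi0)))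
      * (piD Q S true s - piD Q S false s) ^ 2 * (lateIn Q S s - late Q) ^ 2 := by
    rw [VAsfe, Finset.mul_sum, Finset.mul_sum]
    refine Finset.sum_congr rfl fun s _ => ?_
    have := (probC_pos hQ).ne'
    field_simp
  simp only [Obs.LimitCells.Vsfe, limitCells_beta hS hQ, limitCells_betaAll hS hQ,
    limitCells_piD hS, limitCells_probC hS, Vsfe, Vsat, eA, VHsat]
  change _ * ∑ s, (1 / pi0) ^ 2 * (pi0 * p Q S s * _)
    + _ * ∑ s, (1 / (1 - pi0)) ^ 2 * ((1 - pi0) * p Q S s * _) + _ + _ = _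
  rw [← e1, ← e0]
  simp only [limitCells]
  ring

end Population

/-- In a cell with `A_i = a` and `D_i = d` the observed outcome is `Y_i(d)` and the decision is
`D_i(a)`, so apart from the assignment indicator the summand depends on `W_i` only. -/
theorem moment_data {Zc St : Type*} [DecidableEq St] {Ω : ℕ → Type*} (S : Zc → St)
    (W : ∀ n, Fin n → Ω n → Primitive Zc) (A : ∀ n, Fin n → Ω n → Bool) (k : ℕ) (d a : Bool)
    (s : St) (n : ℕ) (ω : Ω n) :
    (data S W A n ω).moment k d a s
      = armAverage W A a ((inStratum S s).indicator (cellFun k d a)) n ω := by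
  rw [Obs.moment, armAverage]
  congr 1
  refine Finset.sum_congr rfl fun i _ => ?_
  simp only [data, observe, Set.indicator_apply, inStratum, Set.mem_ofPred_eq, cellFun]
  by_cases ha : A n i ω = a
  · by_cases hs : stratum S (W n i ω) = s
    · by_cases hd : potD a (W n i ω) = d <;> simp [ha, hs, hd]
    · simp [hs]
  · simp [ha]

end CARLate

end

theorem mainTheorem5 {Zc St : Type*} [MeasurableSpace Zc] [Fintype St] [DecidableEq St]
    [MeasurableSpace St] [MeasurableSingletonClass St]
    {Ω : ℕ → Type*} [∀ n, MeasurableSpace (Ω n)]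
    (P : ∀ n, Measure (Ω n)) [∀ n, IsProbabilityMeasure (P n)]
    (Q : Measure (CARLate.Primitive Zc)) [IsProbabilityMeasure Q]
    (S : Zc → St) (hS : Measurable S)
    (W : ∀ n, Fin n → Ω n → CARLate.Primitive Zc) (A : ∀ n, Fin n → Ω n → Bool)
    (piA tau : St → ℝ) (pi0 : ℝ)
    (h1 : CARLate.SamplingAssumption P W Q S)
    (h3 : CARLate.AssignmentAssumption P W A Q S piA tau pi0) :
    CARLate.TendstoInProb P (fun n ω => (CARLate.data S W A n ω).VsfeHat tau)
      (CARLate.Vsfe Q S piA pi0 tau) := by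
  have hQ : CARLate.PopulationAssumption Q S :=
    ⟨h1.secondMoment, h1.strata_pos, h1.no_defiers, h1.compliers_pos⟩
  rw [CARLate.tendstoInProb_iff, ← CARLate.limitCells_Vsfe hS hQ h3.target_mem h3.const_target]
  refine CARLate.Obs.tendsto_VsfeHat (N := fun x : Σ n, Ω n => x.1)
    (CARLate.limitCells_regular hS hQ h3.target_mem) (fun k hk d a s => ?_)
    (CARLate.eventually_probFilter_of_atTop P (eventually_ne_atTop 0)) tau
  simp only [CARLate.moment_data]
  have e : (CARLate.limitCells Q S pi0).p s * (CARLate.limitCells Q S pi0).m k d a s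
      = ∫ w in CARLate.inStratum S s, CARLate.cellFun k d a w ∂Q :=
    mul_div_cancel₀ _ (h1.strata_pos s).ne'
  rw [e]
  exact CARLate.tendsto_armAverage hS h1 h3 (CARLate.measurable_cellFun k d a)
    (CARLate.integrable_cellFun h1.secondMoment hk d a) a s
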